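/- Let $X\in\mathbb{R}^{n\times d}$, $Y\in\mathbb{R}^{n\times p}$, $\lambda,\rho,\sigma>0$, and let $\mathcal{G}$ be a finite set of (possibly overlapping) groups $g\subseteq\{1,\dots,d\}$ with $\bigcup_{g\in\mathcal{G}}g=\{1,\dots,d\}$. For matrices let $\langle A,B\rangle=\sum_{ij}A_{ij}B_{ij}$, let $\|A\|_F$ be the Frobenius norm, $\|A\|_{2,1}=\sum_j\|A_{*j}\|_2$ the sum of the Euclidean norms of the columns, $\|A\|_1=\sum_{ij}|A_{ij}|$, and $\mathcal{R}_{\mathcal{G}}(W)=\sum_{g\in\mathcal{G}}\|W_{g*}\|_F$, where $W_{g*}$ consists of the rows of $W$ indexed by $g$. Consider $$\min_{W\in\mathbb{R}^{d\times p},\,G\in\mathbb{R}^{n\times p}}\ \|Y-XW-G\|_{2,1}+\lambda\mathcal{R}_{\mathcal{G}}(W)+\rho\|G\|_1. \qquad (1)$$ Let $d'=\sum_{g\in\mathcal{G}}|g|$ and let $C\in\{0,1\}^{d'\times d}$ be the matrix such that $\Upsilon=CW$ lists, for every $g\in\mathcal{G}$, a copy of the rows $W_{i*}$, $i\in g$;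 let $\mathcal{G}'$ be the resulting partition of the $d'$ rows into disjoint groups, one for each $g\in\mathcal{G}$, and $\mathcal{R}_{\mathcal{G}'}(\Upsilon)=\sum_{g'\in\mathcal{G}'}\|\Upsilon_{g'*}\|_F$. Then (1) is equivalent to the split problem $$\min_{Z,\Upsilon,G,W}\ \|Z\|_{2,1}+\lambda\mathcal{R}_{\mathcal{G}'}(\Upsilon)+\rho\|G\|_1\quad\text{s.t.}\quad Z+G+XW=Y,\ \ \Upsilon-CW=0. \qquad (2)$$ The dual problem of (2) is the maximization over $(\Lambda_1,\Lambda_2)$ of $$\inf_{Z,\Upsilon,G,W}\ \|Z\|_{2,1}+\lambda\mathcal{R}_{\mathcal{G}'}(\Upsilon)+\rho\|G\|_1-\langle\Lambda_1,Z+G+XW-Y\rangle-\langle\Lambda_2,\Upsilon-CW\rangle .$$ The KKT conditions for $(\hat Z,\hat\Upsilon,\hat G,\hat W,\hat\Lambda_1,\hat\Lambda_2)$ are $$\hat Z+\hat G+X\hat W=Y,\quad \hat\Upsilon=C\hat W,\quad \hat\Lambda_1\in\partial\|\hat Z\|_{2,1},\quad \hat\Lambda_1\in\rho\,\partial\|\hat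 G\|_1,\quad \hat\Lambda_2\in\lambda\,\partial\mathcal{R}_{\mathcal{G}'}(\hat\Upsilon),\quad X^\top\hat\Lambda_1-C^\top\hat\Lambda_2=0. \qquad (3)$$ Let $A=X^\top X+C^\top C$ and let $\tau\in\bigl(0,(1+\sqrt5)/2\bigr)$. Choose $Z^0,\Upsilon^0,G^0,W^0,\Lambda_1^0,\Lambda_2^0$ such that $$W^0=A^{-1}\bigl(X^\top(Y-Z^0-G^0)+C^\top\Upsilon^0\bigr),\qquad X^\top\Lambda_1^0-C^\top\Lambda_2^0=0,$$ and for $k\ge0$ iterate, with $(\alpha)_+=\max\{\alpha,0\}$: 1. $Z^{k+1}_{*j}=\bigl(1-1/(\sigma\|\Delta_{*j}\|_2)\bigr)_+\Delta_{*j}$ for $j=1,\dots,p$, where $\Delta=Y-XW^k-G^k+\Lambda_1^k/\sigma$; 2. $\Upsilon^{k+1}_{g*}=\bigl(1-\lambda/(\sigma\|\Delta_{g*}\|_F)\bigr)_+\Delta_{g*}$ for $g\in\mathcal{G}'$, where $\Delta=CW^k+\Lambda_2^k/\sigma$; 3. $W^{k+\frac12}=A^{-1}\bigl(X^\top(Y-Z^{k+1}-G^k)+C^\top\Upsilon^{k+1}\bigr)$;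 4. $G^{k+1}_{ij}=\operatorname{sign}(\Delta_{ij})\max\{|\Delta_{ij}|-\rho/\sigma,0\}$, where $\Delta=Y-XW^{k+\frac12}-Z^{k+1}+\Lambda_1^k/\sigma$; 5. $W^{k+1}=A^{-1}\bigl(X^\top(Y-Z^{k+1}-G^{k+1})+C^\top\Upsilon^{k+1}\bigr)$; 6. $\Lambda_1^{k+1}=\Lambda_1^k-\tau\sigma(Z^{k+1}+XW^{k+1}+G^{k+1}-Y)$ and $\Lambda_2^{k+1}=\Lambda_2^k-\tau\sigma(\Upsilon^{k+1}-CW^{k+1})$. (In steps 1 and 2 a zero column or zero block of $\Delta$ is mapped to zero.) Then the whole sequence $(Z^k,\Upsilon^k,G^k,W^k,\Lambda_1^k,\Lambda_2^k)$ converges to a unique point $(\hat Z,\hat\Upsilon,\hat G,\hat W,\hat\Lambda_1,\hat\Lambda_2)$. This point satisfies the KKT conditions (3), $(\hat Z,\hat\Upsilon,\hat G,\hat W)$ is an optimal solution of (2), $(\hat W,\hat G)$ is an optimal solution of (1), and $(\hat\Lambda_1,\hat\Lambda_2)$ is an optimal solution of the dual problem of (2). -/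

import Mathlib

open scoped Matrix Pointwise Topology

noncomputable section

namespace CMRG

/-- The trace inner product `⟨A, B⟩ = ∑ᵢⱼ Aᵢⱼ Bᵢⱼ` of real matrices. -/
def inn {m q : Type*} [Fintype m] [Fintype q] (A B : Matrix m q ℝ) : ℝ :=
  ∑ i, ∑ j, A i j * B i j

/-- The Frobenius norm. -/
def frob {m q : Type*} [Fintype m] [Fintype q] (A : Matrix m q ℝ) : ℝ :=
  Real.sqrt (∑ i, ∑ j, A i j ^ 2)

/-- The Euclidean norm of the `j`-th column. -/
def colNorm {m q : Type*} [Fintype m] (A : Matrix m q ℝ) (j : q) : ℝ :=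
  Real.sqrt (∑ i, A i j ^ 2)

/-- The `ℓ₂,₁`-norm: the sum of the Euclidean norms of the columns. -/
def l21 {m q : Type*} [Fintype m] [Fintype q] (A : Matrix m q ℝ) : ℝ :=
  ∑ j, colNorm A j

/-- The entrywise `ℓ₁`-norm. -/
def l1 {m q : Type*} [Fintype m] [Fintype q] (A : Matrix m q ℝ) : ℝ :=
  ∑ i, ∑ j, |A i j|

/-- The subdifferential of a convex function of a matrix. -/
def subdiff {m q : Type*} [Fintype m] [Fintype q] (φ : Matrix m q ℝ → ℝ) (A : Matrix m q ℝ) :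
    Set (Matrix m q ℝ) :=
  {S | ∀ B, φ A + inn S (B - A) ≤ φ B}

section Groups

variable {d p : ℕ}

/-- The group-lasso penalty `∑_{g ∈ 𝒢} ‖W_{g*}‖_F` of a set of (possibly overlapping) groups. -/
def groupLasso (𝒢 : Finset (Finset (Fin d))) (W : Matrix (Fin d) (Fin p) ℝ) : ℝ :=
  ∑ g ∈ 𝒢, frob (W.submatrix (fun i : g => (i : Fin d)) id)

/-- The row indices of `Υ`: one copy `⟨g, i⟩` of the row `i` for each group `g ∈ 𝒢` containing `i`.
It has `d' = ∑_{g ∈ 𝒢} |g|` elements. -/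
abbrev Dup (𝒢 : Finset (Finset (Fin d))) : Type := Σ g : 𝒢, (g : Finset (Fin d))

/-- The rows of `Υ` in the block of the disjoint partition of the copies belonging to `g`. -/
def block {𝒢 : Finset (Finset (Fin d))} (Υ : Matrix (Dup 𝒢) (Fin p) ℝ) (g : 𝒢) :
    Matrix (g : Finset (Fin d)) (Fin p) ℝ :=
  Υ.submatrix (fun i => (⟨g, i⟩ : Dup 𝒢)) id

/-- The group-lasso penalty of the disjoint (duplicated) groups. -/
def groupLasso' {𝒢 : Finset (Finset (Fin d))} (Υ : Matrix (Dup 𝒢) (Fin p) ℝ) : ℝ :=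
  ∑ g : 𝒢, frob (block Υ g)

/-- The duplication matrix `C`: the row `⟨g, i⟩` of `C W` is the row `i` of `W`. -/
def dupMat (𝒢 : Finset (Finset (Fin d))) : Matrix (Dup 𝒢) (Fin d) ℝ :=
  Matrix.of fun a j => if (a.2 : Fin d) = j then 1 else 0

end Groups

/-- The data of the problem: design matrix `X`, observations `Y`, the set `𝒢` of groups and the
regularization parameters `lam` and `ρ`. -/
structure Problem (n d p : ℕ) where
  X : Matrix (Fin n) (Fin d) ℝ
  Y : Matrix (Fin n) (Fin p) ℝ
  𝒢 : Finset (Finset (Fin d))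
  lam : ℝ
  ρ : ℝ

/-- A tuple `(Z, Υ, G, W, Λ₁, Λ₂)` of primal variables and multipliers. -/
@[ext]
structure State (n d p : ℕ) (𝒢 : Finset (Finset (Fin d))) where
  Z : Matrix (Fin n) (Fin p) ℝ
  Υ : Matrix (Dup 𝒢) (Fin p) ℝ
  G : Matrix (Fin n) (Fin p) ℝ
  W : Matrix (Fin d) (Fin p) ℝ
  Λ₁ : Matrix (Fin n) (Fin p) ℝ
  Λ₂ : Matrix (Dup 𝒢) (Fin p) ℝ

namespace Problem

variable {n d p : ℕ} (P : Problem n d p)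

/-- The matrix `C` of the problem. -/
abbrev C : Matrix (Dup P.𝒢) (Fin d) ℝ := dupMat P.𝒢

/-- `A = XᵀX + D` with `D = CᵀC`. -/
def A : Matrix (Fin d) (Fin d) ℝ := P.Xᵀ * P.X + P.Cᵀ * P.C

/-- The objective of the original problem. -/
def objOrig (W : Matrix (Fin d) (Fin p) ℝ) (G : Matrix (Fin n) (Fin p) ℝ) : ℝ :=
  l21 (P.Y - P.X * W - G) + P.lam * groupLasso P.𝒢 W + P.ρ * l1 G

/-- `(W, G)` is optimal for the original problem. -/
def IsOptimalOrig (W : Matrix (Fin d) (Fin p) ℝ) (G : Matrix (Fin n) (Fin p) ℝ) : Prop :=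
  ∀ W' G', P.objOrig W G ≤ P.objOrig W' G'

/-- The objective of the split problem. -/
def obj (Z : Matrix (Fin n) (Fin p) ℝ) (Υ : Matrix (Dup P.𝒢) (Fin p) ℝ)
    (G : Matrix (Fin n) (Fin p) ℝ) : ℝ :=
  l21 Z + P.lam * groupLasso' Υ + P.ρ * l1 G

/-- The constraints of the split problem. -/
def Feasible (Z : Matrix (Fin n) (Fin p) ℝ) (Υ : Matrix (Dup P.𝒢) (Fin p) ℝ)
    (G : Matrix (Fin n) (Fin p) ℝ) (W : Matrix (Fin d) (Fin p) ℝ) : Prop :=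
  Z + G + P.X * W = P.Y ∧ Υ - P.C * W = 0

/-- `(Z, Υ, G, W)` is optimal for the split problem. -/
def IsOptimal (Z : Matrix (Fin n) (Fin p) ℝ) (Υ : Matrix (Dup P.𝒢) (Fin p) ℝ)
    (G : Matrix (Fin n) (Fin p) ℝ) (W : Matrix (Fin d) (Fin p) ℝ) : Prop :=
  P.Feasible Z Υ G W ∧
    ∀ Z' Υ' G' W', P.Feasible Z' Υ' G' W' → P.obj Z Υ G ≤ P.obj Z' Υ' G'

/-- The Lagrangian of the split problem. -/
def lagrangian (Z : Matrix (Fin n) (Fin p) ℝ) (Υ : Matrix (Dup P.𝒢) (Fin p) ℝ)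
    (G : Matrix (Fin n) (Fin p) ℝ) (W : Matrix (Fin d) (Fin p) ℝ)
    (Λ₁ : Matrix (Fin n) (Fin p) ℝ) (Λ₂ : Matrix (Dup P.𝒢) (Fin p) ℝ) : ℝ :=
  P.obj Z Υ G - inn Λ₁ (Z + G + P.X * W - P.Y) - inn Λ₂ (Υ - P.C * W)

/-- The Lagrange dual function (with values in the extended reals). -/
def dualFun (Λ₁ : Matrix (Fin n) (Fin p) ℝ) (Λ₂ : Matrix (Dup P.𝒢) (Fin p) ℝ) : EReal :=
  ⨅ (Z : Matrix (Fin n) (Fin p) ℝ) (Υ : Matrix (Dup P.𝒢) (Fin p) ℝ)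
    (G : Matrix (Fin n) (Fin p) ℝ) (W : Matrix (Fin d) (Fin p) ℝ),
    ((P.lagrangian Z Υ G W Λ₁ Λ₂ : ℝ) : EReal)

/-- `(Λ₁, Λ₂)` is optimal for the dual problem, the maximization of the dual function. -/
def IsDualOptimal (Λ₁ : Matrix (Fin n) (Fin p) ℝ) (Λ₂ : Matrix (Dup P.𝒢) (Fin p) ℝ) : Prop :=
  P.dualFun Λ₁ Λ₂ ≠ ⊥ ∧ ∀ Λ₁' Λ₂', P.dualFun Λ₁' Λ₂' ≤ P.dualFun Λ₁ Λ₂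

/-- The KKT conditions of the split problem. The last one is stationarity in `W`. -/
def KKT (s : State n d p P.𝒢) : Prop :=
  s.Z + s.G + P.X * s.W = P.Y ∧ s.Υ = P.C * s.W ∧
    s.Λ₁ ∈ subdiff l21 s.Z ∧ s.Λ₁ ∈ P.ρ • subdiff l1 s.G ∧
    s.Λ₂ ∈ P.lam • subdiff groupLasso' s.Υ ∧
    P.Xᵀ * s.Λ₁ - P.Cᵀ * s.Λ₂ = 0

/-- Update of `Z`: shrinkage of the columns of `Δ = Y - X W - G + Λ₁ / σ`. -/
def updZ (σ : ℝ) (G : Matrix (Fin n) (Fin p) ℝ) (W : Matrix (Fin d) (Fin p) ℝ)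
    (Λ₁ : Matrix (Fin n) (Fin p) ℝ) : Matrix (Fin n) (Fin p) ℝ :=
  let Δ := P.Y - P.X * W - G + σ⁻¹ • Λ₁
  Matrix.of fun i j => max (1 - 1 / (σ * colNorm Δ j)) 0 * Δ i j

/-- Update of `Υ`: shrinkage of the row blocks of `Δ = C W + Λ₂ / σ`. -/
def updΥ (σ : ℝ) (W : Matrix (Fin d) (Fin p) ℝ) (Λ₂ : Matrix (Dup P.𝒢) (Fin p) ℝ) :
    Matrix (Dup P.𝒢) (Fin p) ℝ :=
  let Δ := P.C * W + σ⁻¹ • Λ₂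
  Matrix.of fun a j => max (1 - P.lam / (σ * frob (block Δ a.1))) 0 * Δ a j

/-- Update of `W`. -/
def updW (Z : Matrix (Fin n) (Fin p) ℝ) (Υ : Matrix (Dup P.𝒢) (Fin p) ℝ)
    (G : Matrix (Fin n) (Fin p) ℝ) : Matrix (Fin d) (Fin p) ℝ :=
  P.A⁻¹ * (P.Xᵀ * (P.Y - Z - G) + P.Cᵀ * Υ)

/-- Update of `G`: entrywise soft thresholding of `Δ = Y - X W - Z + Λ₁ / σ`. -/
def updG (σ : ℝ) (Z : Matrix (Fin n) (Fin p) ℝ) (W : Matrix (Fin d) (Fin p) ℝ)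
    (Λ₁ : Matrix (Fin n) (Fin p) ℝ) : Matrix (Fin n) (Fin p) ℝ :=
  let Δ := P.Y - P.X * W - Z + σ⁻¹ • Λ₁
  Matrix.of fun i j => Real.sign (Δ i j) * max (|Δ i j| - P.ρ / σ) 0

/-- One iteration of the CMRG algorithm with penalty parameter `σ` and step length `τ`. -/
def step (σ τ : ℝ) (s : State n d p P.𝒢) : State n d p P.𝒢 :=
  let Z := P.updZ σ s.G s.W s.Λ₁
  let Υ := P.updΥ σ s.W s.Λ₂
  let Whalf := P.updW Z Υ s.G
  let G := P.updG σ Z Whalf s.Λ₁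
  let W := P.updW Z Υ G
  { Z := Z
    Υ := Υ
    G := G
    W := W
    Λ₁ := s.Λ₁ - (τ * σ) • (Z + P.X * W + G - P.Y)
    Λ₂ := s.Λ₂ - (τ * σ) • (Υ - P.C * W) }

/-- The conditions on the initial tuple. -/
def IsInit (s : State n d p P.𝒢) : Prop :=
  s.W = P.A⁻¹ * (P.Xᵀ * (P.Y - s.Z - s.G) + P.Cᵀ * s.Υ) ∧
    P.Xᵀ * s.Λ₁ - P.Cᵀ * s.Λ₂ = 0

/-- The `k`-th iterate of the CMRG algorithm started at `s₀`. -/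
def iter (σ τ : ℝ) (s₀ : State n d p P.𝒢) (k : ℕ) : State n d p P.𝒢 :=
  (P.step σ τ)^[k] s₀

end Problem

/-- Convergence of a sequence of tuples: all six components converge. -/
def ConvergesTo {n d p : ℕ} {𝒢 : Finset (Finset (Fin d))} (s : ℕ → State n d p 𝒢)
    (l : State n d p 𝒢) : Prop :=
  Filter.Tendsto (fun k => (s k).Z) Filter.atTop (𝓝 l.Z) ∧
  Filter.Tendsto (fun k => (s k).Υ) Filter.atTop (𝓝 l.Υ) ∧
  Filter.Tendsto (fun k => (s k).G) Filter.atTop (𝓝 l.G) ∧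
  Filter.Tendsto (fun k => (s k).W) Filter.atTop (𝓝 l.W) ∧
  Filter.Tendsto (fun k => (s k).Λ₁) Filter.atTop (𝓝 l.Λ₁) ∧
  Filter.Tendsto (fun k => (s k).Λ₂) Filter.atTop (𝓝 l.Λ₂)

end CMRG

end

/-! Group the variables as `u = (Z, Υ)` and `v = (G, W)`. The split problem becomes `min f u + g v`
subject to `u + B v = c`, with `B (G, W) = (G + X W, -C W)` and `c = (Y, 0)`. The sweep `W`, `G`,
`W` is one exact step in the pair `(G, W)` for the augmented Lagrangian plus `σ / 2 * ‖K (v - v k)‖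
^ 2`, where `‖K (G, W)‖ ^ 2 = ⟨X A⁻¹ Xᵀ G, G⟩`: computing `G` from the half step `W` instead of the
final one produces exactly the gradient of this term (`isProxADMM_iter`). The invariant `Xᵀ Λ₁ = Cᵀ
Λ₂` makes the `W` component of the optimality condition hold.

For the abstract iteration, monotonicity of the subdifferentials and a weighted Young inequality
give a Lyapunov function that decreases relative to every KKT point (`lyapunov_descent`). The
decrease controls the residual and the increments of `B v` if the Young weight lies strictly between
`(1 - τ) ^ 2` and `2 - τ`; such a weight exists because `τ ^ 2 < τ + 1`. Bounded iterates have a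
cluster point, which is again a KKT point; the Lyapunov function relative to it decreases and
vanishes along a subsequence, so the whole sequence converges (`exists_tendsto`).

A KKT point exists by coercivity and separation (`exists_splitKKT`). The covering hypothesis makes
`C` injective, hence `A` invertible and `B` injective, so that `v` is recovered from `B v`.
Optimality in all three problems follows from one saddle-point inequality, `KKT.obj_le_lagrangian`.
-/

noncomputable section

namespace CMRG

open Filter

/-! ### Lyapunov descent for the semi-proximal ADMM -/

section SplitConvex

variable {E V : Type*} [NormedAddCommGroup E] [InnerProductSpace ℝ E]
  [AddCommGroup V] [Module ℝ V]

local notation "⟪" x ", " y "⟫" => inner ℝ x y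

/-- `(u, v, Λ)` is a KKT point of `min f u + g v` subject to `u + B v = c`. -/
structure SplitKKT (f : E → ℝ) (g : V → ℝ) (B : V →ₗ[ℝ] E) (c : E)
    (u : E) (v : V) (Λ : E) : Prop where
  feasible : u + B v = c
  left : ∀ u', f u + ⟪Λ, u' - u⟫ ≤ f u'
  right : ∀ v', g v + ⟪Λ, B (v' - v)⟫ ≤ g v'

/-- The iteration of the semi-proximal ADMM for `min f u + g v` subject to `u + B v = c`, with
penalty `σ`, step length `τ` and proximal term `σ / 2 * ‖K (v - v k)‖ ^ 2` in the second block,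
written in terms of the optimality conditions of the two subproblems. -/
structure IsProxADMM (f : E → ℝ) (g : V → ℝ) (B K : V →ₗ[ℝ] E) (c : E) (σ τ : ℝ)
    (u : ℕ → E) (v : ℕ → V) (Λ : ℕ → E) : Prop where
  left : ∀ k u', f (u (k + 1)) + ⟪Λ k - σ • (u (k + 1) + B (v k) - c), u' - u (k + 1)⟫ ≤ f u'
  right : ∀ k v', g (v (k + 1))
      + ⟪Λ k - σ • (u (k + 1) + B (v (k + 1)) - c), B (v' - v (k + 1))⟫
      - σ * ⟪K (v (k + 1) - v k), K (v' - v (k + 1))⟫ ≤ g v'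
  dual : ∀ k, Λ (k + 1) = Λ k - (τ * σ) • (u (k + 1) + B (v (k + 1)) - c)

/-- The Lyapunov function of the ADMM iteration relative to a point `(w, M)`. -/
def lyapunov (B K : V →ₗ[ℝ] E) (c : E) (σ τ β : ℝ)
    (u : ℕ → E) (v : ℕ → V) (Λ : ℕ → E) (w : V) (M : E) (k : ℕ) : ℝ :=
  (τ * σ)⁻¹ * ‖Λ k - M‖ ^ 2 + σ * ‖B (v k - w)‖ ^ 2 + σ * ‖K (v k - w)‖ ^ 2
    + σ * β * ‖u k + B (v k) - c‖ ^ 2 + σ * ‖K (v k - v (k - 1))‖ ^ 2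

theorem two_mul_inner_le_of_pos {t β : ℝ} (hβ : 0 < β) (x y : E) :
    2 * t * ⟪x, y⟫ ≤ β * ‖x‖ ^ 2 + t ^ 2 / β * ‖y‖ ^ 2 := by
  have h : 0 ≤ β⁻¹ * ‖β • x - t • y‖ ^ 2 := by positivity
  rw [norm_sub_sq_real, norm_smul, norm_smul, inner_smul_left, inner_smul_right, mul_pow, mul_pow,
    Real.norm_eq_abs, Real.norm_eq_abs, sq_abs, sq_abs] at h
  have e : β⁻¹ * (β ^ 2 * ‖x‖ ^ 2 - 2 * (β * (t * ⟪x, y⟫)) + t ^ 2 * ‖y‖ ^ 2)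
      = β * ‖x‖ ^ 2 + t ^ 2 / β * ‖y‖ ^ 2 - 2 * t * ⟪x, y⟫ := by
    field_simp; ring
  simp only [conj_trivial] at h
  linarith

/-- Here `a` is the multiplier error, `r` and `s` the new and old residuals, `x` and `y` the new and
old errors of `B v`. Adding `h₁` and `h₂` leaves the cross term `⟪r, x - y⟫`, whose sign is unknown;
`h₃` trades it for `(1 - τ) * ⟪s, x - y⟫`, which Young's inequality splits between the old residual
and `x - y`. -/
theorem admm_descent_aux {σ τ β : ℝ} (hσ : 0 < σ) (hτ : 0 < τ) (hβ : 0 < β)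
    (a r s x y kx ky kd : E)
    (h₁ : 0 ≤ ⟪a - σ • (r + (y - x)), r - x⟫)
    (h₂ : 0 ≤ ⟪a - σ • r, x⟫ - σ * ⟪kx - ky, kx⟫)
    (h₃ : 0 ≤ ⟪(1 - τ) • s - r, x - y⟫ - ⟪kx - ky - kd, kx - ky⟫) :
    (τ * σ)⁻¹ * ‖a - (τ * σ) • r‖ ^ 2 + σ * ‖x‖ ^ 2 + σ * ‖kx‖ ^ 2
      + σ * β * ‖r‖ ^ 2 + σ * ‖kx - ky‖ ^ 2
      + σ * (2 - τ - β) * ‖r‖ ^ 2 + σ * (1 - (1 - τ) ^ 2 / β) * ‖x - y‖ ^ 2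
    ≤ (τ * σ)⁻¹ * ‖a‖ ^ 2 + σ * ‖y‖ ^ 2 + σ * ‖ky‖ ^ 2 + σ * β * ‖s‖ ^ 2 + σ * ‖kd‖ ^ 2 := by
  have h₄ := two_mul_inner_le_of_pos (t := 1 - τ) hβ s (x - y)
  have h₄' := mul_nonneg hσ.le (sub_nonneg.2 h₄)
  have h₃' := mul_nonneg hσ.le h₃
  -- `h₅` and `h₆` are the surplus squares of the proximal terms, which are discarded.
  have h₅ : 0 ≤ σ * ‖kx - ky - kd‖ ^ 2 := by positivity
  have h₆ : 0 ≤ σ * ‖kx - ky‖ ^ 2 := by positivity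
  have e : (τ * σ)⁻¹ * ‖a - (τ * σ) • r‖ ^ 2
      = (τ * σ)⁻¹ * ‖a‖ ^ 2 - 2 * ⟪a, r⟫ + τ * σ * ‖r‖ ^ 2 := by
    rw [norm_sub_sq_real, norm_smul, inner_smul_right, mul_pow, Real.norm_eq_abs, sq_abs]
    field_simp
  have hk : ‖kx - ky - kd‖ ^ 2 = ‖kx - ky‖ ^ 2 - 2 * ⟪kx - ky, kd⟫ + ‖kd‖ ^ 2 :=
    norm_sub_sq_real _ _
  have hk' : ⟪kx - ky - kd, kx - ky⟫ = ‖kx - ky‖ ^ 2 - ⟪kx - ky, kd⟫ := by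
    rw [inner_sub_left, real_inner_self_eq_norm_sq, real_inner_comm kd]
  have hx : ‖x - y‖ ^ 2 = ‖x‖ ^ 2 - 2 * ⟪x, y⟫ + ‖y‖ ^ 2 := norm_sub_sq_real _ _
  have hkx : ‖kx - ky‖ ^ 2 = ‖kx‖ ^ 2 - 2 * ⟪kx, ky⟫ + ‖ky‖ ^ 2 := norm_sub_sq_real _ _
  rw [e]
  rw [hk, hkx] at h₅
  rw [hkx] at h₆
  rw [hk', hkx] at h₃'
  simp only [inner_sub_left, inner_sub_right, inner_add_left, inner_smul_left,
    real_inner_self_eq_norm_sq, conj_trivial] at h₁ h₂ h₃' h₄' h₅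
  rw [real_inner_comm r x, real_inner_comm r y, real_inner_comm x y] at h₁
  rw [real_inner_comm kx ky] at h₂
  rw [hx] at h₄' ⊢
  rw [hkx]
  linear_combination 2 * h₁ + 2 * h₂ + 2 * h₃' + h₄' + h₅ + h₆

section Descent

variable {f : E → ℝ} {g : V → ℝ} {B K : V →ₗ[ℝ] E} {c : E} {σ τ β : ℝ}
  {u : ℕ → E} {v : ℕ → V} {Λ : ℕ → E}

theorem IsProxADMM.lyapunov_descent (h : IsProxADMM f g B K c σ τ u v Λ)
    (hσ : 0 < σ) (hτ : 0 < τ) (hβ : 0 < β) {a : E} {w : V} {M : E}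
    (hs : SplitKKT f g B c a w M) (k : ℕ) :
    lyapunov B K c σ τ β u v Λ w M (k + 2)
      + σ * (2 - τ - β) * ‖u (k + 2) + B (v (k + 2)) - c‖ ^ 2
      + σ * (1 - (1 - τ) ^ 2 / β) * ‖B (v (k + 2) - v (k + 1))‖ ^ 2
    ≤ lyapunov B K c σ τ β u v Λ w M (k + 1) := by
  have hc := hs.feasible
  have key := admm_descent_aux hσ hτ hβ (Λ (k + 1) - M) (u (k + 2) + B (v (k + 2)) - c)
    (u (k + 1) + B (v (k + 1)) - c) (B (v (k + 2) - w)) (B (v (k + 1) - w))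
    (K (v (k + 2) - w)) (K (v (k + 1) - w)) (K (v (k + 1) - v k)) ?_ ?_ ?_
  · have e₁ : B (v (k + 2) - w) - B (v (k + 1) - w) = B (v (k + 2) - v (k + 1)) := by
      rw [← map_sub]; congr 1; abel
    have e₂ : K (v (k + 2) - w) - K (v (k + 1) - w) = K (v (k + 2) - v (k + 1)) := by
      rw [← map_sub]; congr 1; abel
    have e₃ : Λ (k + 1) - M - (τ * σ) • (u (k + 2) + B (v (k + 2)) - c) = Λ (k + 2) - M := by
      rw [h.dual (k + 1)]; abel
    rw [e₁, e₂, e₃] at key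
    exact key
  -- Monotonicity of the subdifferential of `f` between the iterate and the KKT point.
  · have h₁ := h.left (k + 1) a
    have h₂ := hs.left (u (k + 2))
    have e₁ : u (k + 2) + B (v (k + 2)) - c - B (v (k + 2) - w) = u (k + 2) - a := by
      rw [← hc, map_sub]; abel
    have e₂ : u (k + 2) + B (v (k + 2)) - c + (B (v (k + 1) - w) - B (v (k + 2) - w))
        = u (k + 2) + B (v (k + 1)) - c := by
      rw [map_sub, map_sub]; abel
    rw [e₁, e₂, sub_right_comm, inner_sub_left]
    rw [← neg_sub (u (k + 1 + 1)) a, inner_neg_right] at h₁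
    linarith
  · have h₁ := h.right (k + 1) w
    have h₂ := hs.right (v (k + 2))
    have e₂ : K (v (k + 2) - w) - K (v (k + 1) - w) = K (v (k + 2) - v (k + 1)) := by
      rw [← map_sub]; congr 1; abel
    rw [e₂, sub_right_comm, inner_sub_left]
    rw [← neg_sub (v (k + 1 + 1)) w, map_neg, map_neg, inner_neg_right, inner_neg_right] at h₁
    linarith
  -- Monotonicity of the subdifferential of `g` between two consecutive iterates; the multiplier
  -- update supplies the factor `1 - τ`. Both iterates must come from a step, so descent starts at
  -- index 1.
  · have h₁ := h.right (k + 1) (v (k + 1))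
    have h₂ := h.right k (v (k + 2))
    have e₁ : B (v (k + 2) - w) - B (v (k + 1) - w) = B (v (k + 2) - v (k + 1)) := by
      rw [← map_sub]; congr 1; abel
    have e₂ : K (v (k + 2) - w) - K (v (k + 1) - w) = K (v (k + 2) - v (k + 1)) := by
      rw [← map_sub]; congr 1; abel
    rw [e₁, e₂]
    rw [← neg_sub (v (k + 1 + 1)) (v (k + 1)), map_neg, map_neg, inner_neg_right, inner_neg_right,
      h.dual k] at h₁
    set x := B (v (k + 2) - v (k + 1))
    set y := K (v (k + 2) - v (k + 1))
    set r := u (k + 1) + B (v (k + 1)) - c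
    set s := u (k + 2) + B (v (k + 2)) - c
    refine (mul_nonneg_iff_of_pos_left hσ).1 ?_
    simp only [inner_sub_left, inner_smul_left, conj_trivial] at h₁ h₂ ⊢
    linear_combination h₁ + h₂

theorem lyapunov_nonneg (hσ : 0 < σ) (hτ : 0 < τ) (hβ : 0 < β) (w : V) (M : E) (k : ℕ) :
    0 ≤ lyapunov B K c σ τ β u v Λ w M k := by
  unfold lyapunov; positivity

end Descent

end SplitConvex

/-! ### Null sequences from a descent inequality -/

theorem tendsto_zero_of_descent {Φ x : ℕ → ℝ} (hΦ : ∀ k, 0 ≤ Φ k) (hx : ∀ k, 0 ≤ x k)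
    (h : ∀ k, Φ (k + 1) + x k ≤ Φ k) : Tendsto x atTop (𝓝 0) := by
  have hanti : Antitone Φ := antitone_nat_of_succ_le fun k => by linarith [h k, hx k]
  have hlim := tendsto_atTop_ciInf hanti ⟨0, by rintro _ ⟨k, rfl⟩; exact hΦ k⟩
  have hdiff := hlim.sub ((tendsto_add_atTop_iff_nat 1).2 hlim)
  rw [sub_self] at hdiff
  exact squeeze_zero hx (fun k => by linarith [h k]) hdiff

theorem tendsto_zero_of_mul_norm_sq {E : Type*} [NormedAddCommGroup E] {x : ℕ → E} {C : ℝ}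
    (hC : 0 < C) (h : Tendsto (fun k => C * ‖x k‖ ^ 2) atTop (𝓝 0)) : Tendsto x atTop (𝓝 0) := by
  have h₁ := (h.const_mul C⁻¹).sqrt
  simp only [mul_zero, Real.sqrt_zero] at h₁
  refine tendsto_zero_iff_norm_tendsto_zero.2 (h₁.congr fun k => ?_)
  rw [inv_mul_cancel_left₀ hC.ne', Real.sqrt_sq (norm_nonneg _)]

/-! ### Existence of multipliers and convergence of the abstract iteration -/

section SplitConvex

variable {E V : Type*} [NormedAddCommGroup E] [InnerProductSpace ℝ E] [FiniteDimensional ℝ E]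
  [AddCommGroup V] [Module ℝ V] [TopologicalSpace V] [IsTopologicalAddGroup V]
  [ContinuousSMul ℝ V] [T2Space V] [FiniteDimensional ℝ V]
  {f : E → ℝ} {g : V → ℝ} {B K : V →ₗ[ℝ] E} {c : E} {σ τ β : ℝ}

local notation "⟪" x ", " y "⟫" => inner ℝ x y

theorem exists_isMinOn_split (hf : Continuous f) (hg : Continuous g)
    (hbdd : ∀ M, Bornology.IsBounded {u | f u ≤ M}) (hg₀ : ∀ v, 0 ≤ g v)
    (hB : Function.Injective B) :
    ∃ w, ∀ v, f (c - B w) + g w ≤ f (c - B v) + g v := by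
  obtain ⟨L, hL⟩ := LinearMap.exists_leftInverse_of_injective B (LinearMap.ker_eq_bot.2 hB)
  have hL' : ∀ v, L (B v) = v := fun v => LinearMap.congr_fun hL v
  have hBc := LinearMap.continuous_of_finiteDimensional B
  have hLc := LinearMap.continuous_of_finiteDimensional L
  have hF : Continuous fun v => f (c - B v) + g v := by fun_prop
  refine hF.exists_forall_le' 0 ?_
  set M := f (c - B 0) + g 0
  -- If `v` does no worse than `0`, then `c - B v` lies in a sublevel set of `f` because `g` is
  -- nonnegative, and the left inverse `L` recovers `v` from it.
  have hK : IsCompact ((fun u => L (c - u)) '' closure {u | f u ≤ M}) :=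
    ((hbdd M).isCompact_closure).image (by fun_prop)
  filter_upwards [hK.compl_mem_cocompact] with v hv
  by_contra! hlt
  refine hv ⟨c - B v, subset_closure ?_, ?_⟩
  · change f (c - B v) ≤ M
    linarith [hg₀ v]
  · simp [hL']

/-- The multiplier is the slope of a hyperplane supporting the perturbation function `x ↦ inf f (x +
c - B v) + g v` at `0`. Since `f` is finite everywhere, every perturbation is feasible, the strict
epigraph `S` is open, and no further constraint qualification is needed. -/
theorem exists_splitKKT (hf : Continuous f) (hg : Continuous g)
    (hfc : ConvexOn ℝ Set.univ f) (hgc : ConvexOn ℝ Set.univ g)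
    (hbdd : ∀ M, Bornology.IsBounded {u | f u ≤ M}) (hg₀ : ∀ v, 0 ≤ g v)
    (hB : Function.Injective B) (c : E) :
    ∃ a w M, SplitKKT f g B c a w M := by
  obtain ⟨w, hw⟩ := exists_isMinOn_split (c := c) hf hg hbdd hg₀ hB
  set m := f (c - B w) + g w
  let S : Set (E × ℝ) := {q | ∃ v, f (q.1 + c - B v) + g v < q.2}
  have hSo : IsOpen S := by
    have : S = ⋃ v, {q : E × ℝ | f (q.1 + c - B v) + g v < q.2} := by
      ext q; simp [S]
    rw [this]
    exact isOpen_iUnion fun v => isOpen_lt (by fun_prop) continuous_snd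
  have hSc : Convex ℝ S := by
    rintro ⟨x, s⟩ ⟨v, hv⟩ ⟨y, t⟩ ⟨v', hv'⟩ α β hα hβ hαβ
    refine ⟨α • v + β • v', ?_⟩
    have e : (α • (x, s) + β • (y, t)).1 + c - B (α • v + β • v')
        = α • (x + c - B v) + β • (y + c - B v') := by
      have : c = α • c + β • c := by rw [← add_smul, hαβ, one_smul]
      simp only [Prod.fst_add, Prod.smul_fst, map_add, map_smul, smul_sub, smul_add]
      nth_rewrite 1 [this]
      abel
    rw [e]
    have h₁ := hfc.2 (Set.mem_univ (x + c - B v)) (Set.mem_univ (y + c - B v')) hα hβ hαβ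
    have h₂ := hgc.2 (Set.mem_univ v) (Set.mem_univ v') hα hβ hαβ
    simp only [smul_eq_mul, Prod.snd_add, Prod.smul_snd] at h₁ h₂ hv hv' ⊢
    -- The strict inequality survives through whichever weight is positive.
    rcases hα.eq_or_lt with rfl | hα'
    · obtain rfl : β = 1 := by linarith
      linarith
    · nlinarith
  have hS₀ : ((0 : E), m) ∉ S := by
    rintro ⟨v, hv⟩
    have := hw v
    simp only [zero_add] at hv
    linarith
  obtain ⟨ℓ, hℓ⟩ := geometric_hahn_banach_open_point hSc hSo hS₀
  have hsplit : ∀ x t, ℓ (x, t) = ℓ (x, 0) + t * ℓ (0, 1) := fun x t => by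
    rw [← smul_eq_mul, ← map_smul, ← map_add]; simp
  -- The hyperplane is not vertical: `(0, m + 1)` lies in `S` directly above `(0, m)`.
  have hα : ℓ (0, 1) < 0 := by
    have := hℓ (0, m + 1) ⟨w, by simp [m]⟩
    rw [hsplit 0 (m + 1), hsplit 0 m] at this
    linarith
  set α := ℓ (0, 1)
  let M : E := (InnerProductSpace.toDual ℝ E).symm
    ((-α)⁻¹ • ℓ.comp (ContinuousLinearMap.inl ℝ E ℝ))
  have hM : ∀ x, ⟪M, x⟫ = (-α)⁻¹ * ℓ (x, 0) := fun x => by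
    rw [InnerProductSpace.toDual_symm_apply]; rfl
  have key : ∀ u v, m + ⟪M, u + B v - c⟫ ≤ f u + g v := fun u v => by
    -- The slack `ε` places the point in the strict epigraph.
    refine le_of_forall_pos_le_add fun ε hε => ?_
    have h₁ := hℓ (u + B v - c, f u + g v + ε) ⟨v, by simp [hε]⟩
    rw [hsplit, hsplit 0 m] at h₁
    have h₀ : ℓ ((0 : E), (0 : ℝ)) = 0 := map_zero ℓ
    have h₂ : ℓ (u + B v - c, 0) = -α * ⟪M, u + B v - c⟫ := by
      rw [hM, mul_inv_cancel_left₀ (by linarith)]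
    rw [h₀, h₂] at h₁
    have : 0 < -α := by linarith
    refine le_of_mul_le_mul_left (a := -α) ?_ this
    linarith
  refine ⟨c - B w, w, M, ?_, fun u' => ?_, fun v' => ?_⟩
  · abel
  · have := key u' w
    rw [show u' + B w - c = u' - (c - B w) by abel] at this
    linarith
  · have := key (c - B w) v'
    rw [show c - B w + B v' - c = B (v' - w) by rw [map_sub]; abel] at this
    linarith

variable {u : ℕ → E} {v : ℕ → V} {Λ : ℕ → E}

theorem exists_young_weight (hτ : 0 < τ) (hτ' : τ < (1 + Real.sqrt 5) / 2) :
    ∃ β, 0 < β ∧ 0 < 2 - τ - β ∧ 0 < 1 - (1 - τ) ^ 2 / β := by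
  have h5 : Real.sqrt 5 ^ 2 = 5 := Real.sq_sqrt (by norm_num)
  have h5' : 0 ≤ Real.sqrt 5 := Real.sqrt_nonneg 5
  have h5₁ : 1 < Real.sqrt 5 := by nlinarith
  have hlt : (1 - τ) ^ 2 < 2 - τ := by
    -- The claim is `τ ^ 2 - τ - 1 < 0`, and the roots of this quadratic are `(1 ± √5) / 2`. The
    -- weight `β` is then the midpoint of the interval.
    nlinarith [mul_pos (sub_pos.2 hτ') (show 0 < τ - (1 - Real.sqrt 5) / 2 by linarith)]
  have hβ : 0 < ((1 - τ) ^ 2 + (2 - τ)) / 2 := by nlinarith [sq_nonneg (1 - τ)]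
  refine ⟨((1 - τ) ^ 2 + (2 - τ)) / 2, hβ, by linarith, ?_⟩
  rw [sub_pos, div_lt_one hβ]
  linarith

theorem IsProxADMM.exists_tendsto (h : IsProxADMM f g B K c σ τ u v Λ)
    (hf : Continuous f) (hg : Continuous g) (hB : Function.Injective B)
    (hσ : 0 < σ) (hτ : 0 < τ) (hτ' : τ < (1 + Real.sqrt 5) / 2)
    (hs : ∃ a w M, SplitKKT f g B c a w M) :
    ∃ a w M, SplitKKT f g B c a w M ∧
      Tendsto u atTop (𝓝 a) ∧ Tendsto v atTop (𝓝 w) ∧ Tendsto Λ atTop (𝓝 M) := by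
  obtain ⟨β, hβ, hβ₁, hβ₂⟩ := exists_young_weight hτ hτ'
  obtain ⟨L, hL⟩ := LinearMap.exists_leftInverse_of_injective B (LinearMap.ker_eq_bot.2 hB)
  have hL' : ∀ v, L (B v) = v := fun v => LinearMap.congr_fun hL v
  have hBc := LinearMap.continuous_of_finiteDimensional B
  have hKc := LinearMap.continuous_of_finiteDimensional K
  have hLc := LinearMap.continuous_of_finiteDimensional L
  have hτσ : 0 < τ * σ := mul_pos hτ hσ
  have hanti : ∀ {a w M}, SplitKKT f g B c a w M →
      Antitone fun k => lyapunov B K c σ τ β u v Λ w M (k + 1) := fun hs =>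
    antitone_nat_of_succ_le fun k => by
      have h₁ := h.lyapunov_descent hσ hτ hβ hs k
      have h₂ : 0 ≤ σ * (2 - τ - β) * ‖u (k + 2) + B (v (k + 2)) - c‖ ^ 2 := by positivity
      have h₃ : 0 ≤ σ * (1 - (1 - τ) ^ 2 / β) * ‖B (v (k + 2) - v (k + 1))‖ ^ 2 := by positivity
      change lyapunov B K c σ τ β u v Λ _ _ (k + 2) ≤ _
      linarith
  obtain ⟨a₀, w₀, M₀, hs₀⟩ := hs
  have hres : Tendsto (fun k => u (k + 2) + B (v (k + 2)) - c) atTop (𝓝 0) := by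
    refine tendsto_zero_of_mul_norm_sq (mul_pos hσ hβ₁) (tendsto_zero_of_descent
      (Φ := fun k => lyapunov B K c σ τ β u v Λ w₀ M₀ (k + 1))
      (fun k => lyapunov_nonneg hσ hτ hβ w₀ M₀ _) (fun k => by positivity) fun k => ?_)
    have h₁ := h.lyapunov_descent hσ hτ hβ hs₀ k
    have h₃ : 0 ≤ σ * (1 - (1 - τ) ^ 2 / β) * ‖B (v (k + 2) - v (k + 1))‖ ^ 2 := by positivity
    linarith
  have hinc : Tendsto (fun k => v (k + 2) - v (k + 1)) atTop (𝓝 0) := by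
    have : Tendsto (fun k => B (v (k + 2) - v (k + 1))) atTop (𝓝 0) := by
      refine tendsto_zero_of_mul_norm_sq (mul_pos hσ hβ₂) (tendsto_zero_of_descent
        (Φ := fun k => lyapunov B K c σ τ β u v Λ w₀ M₀ (k + 1))
        (fun k => lyapunov_nonneg hσ hτ hβ w₀ M₀ _) (fun k => by positivity) fun k => ?_)
      have h₁ := h.lyapunov_descent hσ hτ hβ hs₀ k
      have h₂ : 0 ≤ σ * (2 - τ - β) * ‖u (k + 2) + B (v (k + 2)) - c‖ ^ 2 := by positivity
      linarith
    have h₂ := (hLc.tendsto 0).comp this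
    simpa [Function.comp_def, hL', -map_sub] using h₂
  -- a cluster point
  obtain ⟨q, φ, hφ, hq⟩ : ∃ q : E × E, ∃ φ : ℕ → ℕ, StrictMono φ ∧
      Tendsto (fun k => (Λ (φ k + 2) - M₀, B (v (φ k + 2) - w₀))) atTop (𝓝 q) := by
    set C := lyapunov B K c σ τ β u v Λ w₀ M₀ 1
    have hC : 0 ≤ C := lyapunov_nonneg hσ hτ hβ w₀ M₀ _
    obtain ⟨q, -, φ, hφ, hq⟩ := tendsto_subseq_of_bounded
      (Metric.isBounded_closedBall (x := (0 : E)) (r := Real.sqrt (τ * σ * C)) |>.prod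
        (Metric.isBounded_closedBall (x := (0 : E)) (r := Real.sqrt (σ⁻¹ * C))))
      (x := fun k => (Λ (k + 2) - M₀, B (v (k + 2) - w₀))) (fun k => by
        have h₁ : lyapunov B K c σ τ β u v Λ w₀ M₀ (k + 2) ≤ C := hanti hs₀ (Nat.zero_le (k + 1))
        have t₁ : 0 ≤ (τ * σ)⁻¹ * ‖Λ (k + 2) - M₀‖ ^ 2 := by positivity
        have t₂ : 0 ≤ σ * ‖B (v (k + 2) - w₀)‖ ^ 2 := by positivity
        have t₃ : 0 ≤ σ * ‖K (v (k + 2) - w₀)‖ ^ 2 := by positivity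
        have t₄ : 0 ≤ σ * β * ‖u (k + 2) + B (v (k + 2)) - c‖ ^ 2 := by positivity
        have t₅ : 0 ≤ σ * ‖K (v (k + 2) - v (k + 2 - 1))‖ ^ 2 := by positivity
        unfold lyapunov at h₁
        refine ⟨mem_closedBall_zero_iff.2 (Real.le_sqrt_of_sq_le ?_),
          mem_closedBall_zero_iff.2 (Real.le_sqrt_of_sq_le ?_)⟩
        · rw [← inv_mul_le_iff₀ hτσ]; linarith
        · rw [le_inv_mul_iff₀ hσ]; linarith)
    exact ⟨q, φ, hφ, hq⟩
  have hφt := hφ.tendsto_atTop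
  obtain ⟨M, hΛ₂⟩ : ∃ M, Tendsto (fun k => Λ (φ k + 2)) atTop (𝓝 M) :=
    ⟨q.1 + M₀, by simpa using ((continuous_fst.tendsto q).comp hq).add_const M₀⟩
  obtain ⟨w, hv₂⟩ : ∃ w, Tendsto (fun k => v (φ k + 2)) atTop (𝓝 w) :=
    ⟨L q.2 + w₀, by
      have := ((hLc.tendsto _).comp ((continuous_snd.tendsto q).comp hq)).add_const w₀
      simpa [Function.comp_def, hL', -map_sub] using this⟩
  have hr := hres.comp hφt
  have hd := hinc.comp hφt
  have hv₁ : Tendsto (fun k => v (φ k + 1)) atTop (𝓝 w) := by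
    simpa [Function.comp_def] using hv₂.sub hd
  have hu₂ : Tendsto (fun k => u (φ k + 2)) atTop (𝓝 (c - B w)) := by
    have := (hr.sub ((hBc.tendsto w).comp hv₂)).add_const c
    simp only [Function.comp_def, zero_sub] at this
    rw [show c - B w = -B w + c by abel]
    refine this.congr fun k => ?_
    abel
  have hΛ₁ : Tendsto (fun k => Λ (φ k + 1)) atTop (𝓝 M) := by
    have := hΛ₂.add (hr.const_smul (τ * σ))
    rw [smul_zero, add_zero] at this
    refine this.congr fun k => ?_
    simp only [Function.comp_def]
    rw [h.dual (φ k + 1)]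
    abel
  -- Both optimality inequalities pass to the limit: `f` and `g` are continuous, the residual tends
  -- to zero, and the proximal term vanishes with the increments of `v`.
  have hs : SplitKKT f g B c (c - B w) w M := by
    refine ⟨by abel, fun u' => ?_, fun v' => ?_⟩
    · have h₁ : Tendsto (fun k => Λ (φ k + 1) - σ • (u (φ k + 2) + B (v (φ k + 1)) - c)) atTop
          (𝓝 (M - σ • (c - B w + B w - c))) :=
        hΛ₁.sub (((hu₂.add ((hBc.tendsto w).comp hv₁)).sub_const c).const_smul σ)
      have h₂ := ((hf.tendsto _).comp hu₂).add (h₁.inner (tendsto_const_nhds (x := u').sub hu₂))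
      have h₃ := le_of_tendsto' h₂ fun k => h.left (φ k + 1) u'
      simpa using h₃
    · have h₁ := hΛ₁.sub (hr.const_smul σ)
      have h₂ := (((hg.tendsto _).comp hv₂).add (h₁.inner
        ((hBc.tendsto _).comp (tendsto_const_nhds (x := v').sub hv₂)))).sub
        ((((hKc.tendsto _).comp hd).inner
          ((hKc.tendsto _).comp (tendsto_const_nhds (x := v').sub hv₂))).const_mul σ)
      have h₃ := le_of_tendsto' h₂ fun k => h.right (φ k + 1) v'
      simpa using h₃
  -- The reference point is now the cluster point itself: an antitone sequence with a subsequence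
  -- tending to zero tends to zero.
  have hlyap : Tendsto (fun k => lyapunov B K c σ τ β u v Λ w M (k + 1)) atTop (𝓝 0) := by
    refine (tendsto_iff_tendsto_subseq_of_antitone (hanti hs)
      (tendsto_atTop_mono (fun k => Nat.le_succ (φ k)) hφt)).2 ?_
    have t₁ := ((hΛ₂.sub_const M).norm.pow 2).const_mul (τ * σ)⁻¹
    have t₂ := (((hBc.tendsto _).comp (hv₂.sub_const w)).norm.pow 2).const_mul σ
    have t₃ := (((hKc.tendsto _).comp (hv₂.sub_const w)).norm.pow 2).const_mul σ
    have t₄ := (hr.norm.pow 2).const_mul (σ * β)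
    have t₅ := (((hKc.tendsto _).comp hd).norm.pow 2).const_mul σ
    have := (((t₁.add t₂).add t₃).add t₄).add t₅
    simp only [sub_self, map_zero, norm_zero, ne_eq, OfNat.ofNat_ne_zero, not_false_eq_true,
      zero_pow, mul_zero, add_zero] at this
    exact this
  have hΛ : Tendsto Λ atTop (𝓝 M) := by
    rw [← tendsto_add_atTop_iff_nat 1, ← tendsto_sub_nhds_zero_iff]
    refine tendsto_zero_of_mul_norm_sq (inv_pos.2 hτσ)
      (squeeze_zero (fun k => by positivity) (fun k => ?_) hlyap)
    unfold lyapunov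
    have t₂ : 0 ≤ σ * ‖B (v (k + 1) - w)‖ ^ 2 := by positivity
    have t₃ : 0 ≤ σ * ‖K (v (k + 1) - w)‖ ^ 2 := by positivity
    have t₄ : 0 ≤ σ * β * ‖u (k + 1) + B (v (k + 1)) - c‖ ^ 2 := by positivity
    have t₅ : 0 ≤ σ * ‖K (v (k + 1) - v (k + 1 - 1))‖ ^ 2 := by positivity
    linarith
  have hBv : Tendsto (fun k => B (v (k + 1) - w)) atTop (𝓝 0) := by
    refine tendsto_zero_of_mul_norm_sq hσ
      (squeeze_zero (fun k => by positivity) (fun k => ?_) hlyap)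
    unfold lyapunov
    have t₁ : 0 ≤ (τ * σ)⁻¹ * ‖Λ (k + 1) - M‖ ^ 2 := by positivity
    have t₃ : 0 ≤ σ * ‖K (v (k + 1) - w)‖ ^ 2 := by positivity
    have t₄ : 0 ≤ σ * β * ‖u (k + 1) + B (v (k + 1)) - c‖ ^ 2 := by positivity
    have t₅ : 0 ≤ σ * ‖K (v (k + 1) - v (k + 1 - 1))‖ ^ 2 := by positivity
    linarith
  have hv : Tendsto v atTop (𝓝 w) := by
    rw [← tendsto_add_atTop_iff_nat 1]
    have := ((hLc.tendsto 0).comp hBv).add_const w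
    simpa [Function.comp_def, hL', -map_sub] using this
  refine ⟨_, w, M, hs, ?_, hv, hΛ⟩
  have := (((tendsto_add_atTop_iff_nat (f := fun k => u k + B (v k) - c) 2).1 hres).sub
    ((hBc.tendsto w).comp hv)).add_const c
  simp only [Function.comp_def, zero_sub] at this
  rw [show c - B w = -B w + c by abel]
  refine this.congr fun k => ?_
  abel

end SplitConvex

/-! ### Matrices as Euclidean vectors and the trace inner product -/

section Vectorization

variable {m q : Type*}

/-- The vector of all entries of a matrix. -/
def flat : Matrix m q ℝ →ₗ[ℝ] EuclideanSpace ℝ (m × q) where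
  toFun A := WithLp.toLp 2 fun i => A i.1 i.2
  map_add' _ _ := rfl
  map_smul' _ _ := rfl

/-- The `j`-th column as a Euclidean vector. -/
def colVec (j : q) : Matrix m q ℝ →ₗ[ℝ] EuclideanSpace ℝ m where
  toFun A := WithLp.toLp 2 fun i => A i j
  map_add' _ _ := rfl
  map_smul' _ _ := rfl

@[simp]
theorem flat_apply (A : Matrix m q ℝ) (i : m × q) : flat A i = A i.1 i.2 := rfl

@[simp]
theorem colVec_apply (A : Matrix m q ℝ) (i : m) (j : q) : colVec j A i = A i j := rfl

theorem colNorm_eq_norm [Fintype m] (A : Matrix m q ℝ) (j : q) : colNorm A j = ‖colVec j A‖ := by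
  simp [colNorm, EuclideanSpace.norm_eq]

theorem abs_le_colNorm [Fintype m] (A : Matrix m q ℝ) (i : m) (j : q) : |A i j| ≤ colNorm A j := by
  rw [colNorm_eq_norm]
  exact PiLp.norm_apply_le (colVec j A) i

end Vectorization

section InnerProduct

variable {m q l : Type*} [Fintype m] [Fintype q] [Fintype l]

theorem inn_eq_trace (A B : Matrix m q ℝ) : inn A B = (Aᵀ * B).trace := by
  simp only [inn, Matrix.trace, Matrix.diag, Matrix.mul_apply, Matrix.transpose_apply]
  exact Finset.sum_comm

theorem inn_comm (A B : Matrix m q ℝ) : inn A B = inn B A := by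
  simp only [inn, mul_comm]

theorem inn_add_left (A B D : Matrix m q ℝ) : inn (A + B) D = inn A D + inn B D := by
  simp [inn_eq_trace, Matrix.add_mul]

theorem inn_sub_left (A B D : Matrix m q ℝ) : inn (A - B) D = inn A D - inn B D := by
  simp [inn_eq_trace, Matrix.sub_mul]

theorem inn_smul_left (t : ℝ) (A B : Matrix m q ℝ) : inn (t • A) B = t * inn A B := by
  simp [inn_eq_trace]

theorem inn_add_right (A B D : Matrix m q ℝ) : inn A (B + D) = inn A B + inn A D := by
  simp [inn_eq_trace, Matrix.mul_add]

theorem inn_sub_right (A B D : Matrix m q ℝ) : inn A (B - D) = inn A B - inn A D := by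
  simp [inn_eq_trace, Matrix.mul_sub]

theorem inn_zero_left (A : Matrix m q ℝ) : inn 0 A = 0 := by simp [inn]

theorem inn_zero_right (A : Matrix m q ℝ) : inn A 0 = 0 := by simp [inn]

theorem inn_neg_right (A B : Matrix m q ℝ) : inn A (-B) = -inn A B := by
  simp [inn_eq_trace]

theorem inn_mul_right (A : Matrix m q ℝ) (X : Matrix m l ℝ) (B : Matrix l q ℝ) :
    inn A (X * B) = inn (Xᵀ * A) B := by
  simp [inn_eq_trace, Matrix.mul_assoc]

theorem eq_zero_of_inn_self_nonpos {A : Matrix m q ℝ} (h : inn A A ≤ 0) : A = 0 := by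
  have h₀ : inn A A = 0 :=
    h.antisymm (Finset.sum_nonneg fun i _ => Finset.sum_nonneg fun j _ => mul_self_nonneg _)
  ext i j
  have h₁ := (Finset.sum_eq_zero_iff_of_nonneg fun i _ =>
    Finset.sum_nonneg fun j _ => mul_self_nonneg (A i j)).1 h₀ i (Finset.mem_univ _)
  exact mul_self_eq_zero.1
    ((Finset.sum_eq_zero_iff_of_nonneg fun j _ => mul_self_nonneg (A i j)).1 h₁ j
      (Finset.mem_univ _))

theorem frob_eq_norm (A : Matrix m q ℝ) : frob A = ‖flat A‖ := by
  simp [frob, EuclideanSpace.norm_eq, Fintype.sum_prod_type]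

theorem inn_eq_inner_flat (A B : Matrix m q ℝ) : inn A B = inner ℝ (flat A) (flat B) := by
  simp [inn, PiLp.inner_apply, Fintype.sum_prod_type, mul_comm]

theorem inn_eq_sum_inner_colVec (A B : Matrix m q ℝ) :
    inn A B = ∑ j, inner ℝ (colVec j A) (colVec j B) := by
  simp only [inn, PiLp.inner_apply]
  rw [Finset.sum_comm]
  simp [mul_comm]

theorem abs_le_frob (A : Matrix m q ℝ) (i : m) (j : q) : |A i j| ≤ frob A := by
  rw [frob_eq_norm]
  exact PiLp.norm_apply_le (flat A) (i, j)

end InnerProduct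

/-! ### Soft thresholding as a proximal map -/

section Shrinkage

variable {F : Type*} [NormedAddCommGroup F] [InnerProductSpace ℝ F]

/-- Block soft thresholding solves the proximal problem of a multiple of a Euclidean norm. -/
theorem shrink_subgradient {κ σ : ℝ} (hκ : 0 ≤ κ) (hσ : 0 < σ) {x s : F}
    (hs : s = max (1 - κ / (σ * ‖x‖)) 0 • x) (b : F) :
    κ * ‖s‖ + inner ℝ (σ • (x - s)) (b - s) ≤ κ * ‖b‖ := by
  -- By Cauchy–Schwarz, a vector of norm at most `κ` whose pairing with `s` is `κ * ‖s‖` is a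
  -- subgradient of `κ * ‖·‖` at `s`.
  suffices h : ‖σ • (x - s)‖ ≤ κ ∧ inner ℝ (σ • (x - s)) s = κ * ‖s‖ by
    rw [inner_sub_right, h.2]
    have := (real_inner_le_norm (σ • (x - s)) b).trans
      (mul_le_mul_of_nonneg_right h.1 (norm_nonneg b))
    linarith
  rcases eq_or_ne x 0 with rfl | hx
  -- Division by zero gives the factor `1` here, and `s = 0` all the same.
  · simp_all
  have hx' : 0 < ‖x‖ := norm_pos_iff.2 hx
  rcases le_total (σ * ‖x‖) κ with h | h
  · have : 1 - κ / (σ * ‖x‖) ≤ 0 := by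
      rw [sub_nonpos, one_le_div (by positivity)]; exact h
    rw [max_eq_right this, zero_smul] at hs
    subst hs
    simpa [norm_smul, abs_of_pos hσ] using h
  · have h₁ : 0 ≤ 1 - κ / (σ * ‖x‖) := by
      rw [sub_nonneg, div_le_one (by positivity)]; exact h
    rw [max_eq_left h₁] at hs
    have e : σ • (x - s) = (κ / ‖x‖) • x := by
      rw [hs, sub_smul, one_smul, sub_sub_cancel, smul_smul]
      congr 1
      field_simp
    rw [e]
    refine ⟨?_, ?_⟩
    · rw [norm_smul, Real.norm_of_nonneg (by positivity), div_mul_cancel₀ _ hx'.ne']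
    · rw [hs, inner_smul_left, inner_smul_right, norm_smul, Real.norm_of_nonneg h₁,
        real_inner_self_eq_norm_sq, conj_trivial]
      field_simp

/-- Entrywise soft thresholding is block shrinkage in dimension one, so `shrink_subgradient` also
covers the update of `G`. -/
theorem soft_threshold_eq {κ σ : ℝ} (hσ : 0 < σ) (x : ℝ) :
    Real.sign x * max (|x| - κ / σ) 0 = max (1 - κ / (σ * ‖x‖)) 0 • x := by
  rcases eq_or_ne x 0 with rfl | hx
  · simp
  have hx' : 0 < |x| := abs_pos.2 hx
  have e : |x| - κ / σ = |x| * (1 - κ / (σ * |x|)) := by field_simp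
  have e₀ : max (|x| * (1 - κ / (σ * |x|))) 0 = |x| * max (1 - κ / (σ * |x|)) 0 := by
    rw [mul_max_of_nonneg _ _ hx'.le, mul_zero]
  rw [e, e₀, Real.norm_eq_abs, smul_eq_mul]
  have hsign : Real.sign x * |x| = x := by
    rcases hx.lt_or_gt with h | h
    · rw [Real.sign_of_neg h, abs_of_neg h]; ring
    · rw [Real.sign_of_pos h, abs_of_pos h, one_mul]
  rw [← mul_assoc, hsign, mul_comm]

end Shrinkage

/-! ### Convexity, continuity and coercivity of the penalties -/

section Penalties

variable {m q : Type*} [Fintype m] [Fintype q]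

theorem convexOn_of_sublinear {V : Type*} [AddCommGroup V] [Module ℝ V] {φ : V → ℝ}
    (hadd : ∀ x y, φ (x + y) ≤ φ x + φ y) (hsmul : ∀ t : ℝ, 0 ≤ t → ∀ x, φ (t • x) = t * φ x) :
    ConvexOn ℝ Set.univ φ :=
  ⟨convex_univ, fun x _ y _ a b ha hb _ => by
    simpa only [hsmul a ha, hsmul b hb, smul_eq_mul] using hadd (a • x) (b • y)⟩

theorem l21_eq (A : Matrix m q ℝ) : l21 A = ∑ j, ‖colVec j A‖ := by
  simp [l21, colNorm_eq_norm]

theorem convexOn_l21 : ConvexOn ℝ Set.univ (l21 : Matrix m q ℝ → ℝ) := by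
  refine convexOn_of_sublinear (fun A B => ?_) fun t ht A => ?_
  · simp only [l21_eq, map_add, ← Finset.sum_add_distrib]
    exact Finset.sum_le_sum fun j _ => norm_add_le _ _
  · simp [l21_eq, norm_smul, abs_of_nonneg ht, Finset.mul_sum]

theorem continuous_l21 : Continuous (l21 : Matrix m q ℝ → ℝ) := by
  unfold l21 colNorm; fun_prop

theorem l21_nonneg (A : Matrix m q ℝ) : 0 ≤ l21 A :=
  Finset.sum_nonneg fun _ _ => Real.sqrt_nonneg _

theorem abs_le_l21 (A : Matrix m q ℝ) (i : m) (j : q) : |A i j| ≤ l21 A :=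
  (abs_le_colNorm A i j).trans
    (Finset.single_le_sum (f := colNorm A) (fun _ _ => Real.sqrt_nonneg _) (Finset.mem_univ j))

theorem convexOn_l1 : ConvexOn ℝ Set.univ (l1 : Matrix m q ℝ → ℝ) := by
  refine convexOn_of_sublinear (fun A B => ?_) fun t ht A => ?_
  · simp only [l1, ← Finset.sum_add_distrib]
    exact Finset.sum_le_sum fun i _ => Finset.sum_le_sum fun j _ => abs_add_le _ _
  · simp [l1, abs_mul, abs_of_nonneg ht, Finset.mul_sum]

theorem continuous_l1 : Continuous (l1 : Matrix m q ℝ → ℝ) := by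
  unfold l1; fun_prop

theorem l1_nonneg (A : Matrix m q ℝ) : 0 ≤ l1 A :=
  Finset.sum_nonneg fun _ _ => Finset.sum_nonneg fun _ _ => abs_nonneg _

variable {d p : ℕ} {𝒢 : Finset (Finset (Fin d))}

/-- The vector of all entries of a block of rows. -/
def blockVec (g : 𝒢) :
    Matrix (Dup 𝒢) (Fin p) ℝ →ₗ[ℝ] EuclideanSpace ℝ (↥(g : Finset (Fin d)) × Fin p) where
  toFun A := flat (block A g)
  map_add' _ _ := rfl
  map_smul' _ _ := rfl

theorem groupLasso'_eq (A : Matrix (Dup 𝒢) (Fin p) ℝ) :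
    groupLasso' A = ∑ g : 𝒢, ‖blockVec g A‖ := by
  simp only [groupLasso', frob_eq_norm]
  rfl

theorem inn_eq_sum_inner_blockVec (A B : Matrix (Dup 𝒢) (Fin p) ℝ) :
    inn A B = ∑ g : 𝒢, inner ℝ (blockVec g A) (blockVec g B) := by
  unfold inn
  rw [Fintype.sum_sigma]
  refine Finset.sum_congr rfl fun g _ => ?_
  exact inn_eq_inner_flat (block A g) (block B g)

theorem convexOn_groupLasso' :
    ConvexOn ℝ Set.univ (groupLasso' : Matrix (Dup 𝒢) (Fin p) ℝ → ℝ) := by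
  refine convexOn_of_sublinear (fun A B => ?_) fun t ht A => ?_
  · simp only [groupLasso'_eq, map_add, ← Finset.sum_add_distrib]
    exact Finset.sum_le_sum fun j _ => norm_add_le _ _
  · simp only [groupLasso'_eq, map_smul, norm_smul, Real.norm_of_nonneg ht, Finset.mul_sum]

theorem continuous_groupLasso' :
    Continuous (groupLasso' : Matrix (Dup 𝒢) (Fin p) ℝ → ℝ) := by
  unfold groupLasso' frob block; simp only [Matrix.submatrix_apply]; fun_prop

theorem groupLasso'_nonneg (A : Matrix (Dup 𝒢) (Fin p) ℝ) : 0 ≤ groupLasso' A :=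
  Finset.sum_nonneg fun _ _ => Real.sqrt_nonneg _

theorem abs_le_groupLasso' (A : Matrix (Dup 𝒢) (Fin p) ℝ) (a : Dup 𝒢) (j : Fin p) :
    |A a j| ≤ groupLasso' A :=
  (abs_le_frob (block A a.1) a.2 j).trans
    (Finset.single_le_sum (f := fun g => frob (block A g)) (fun _ _ => Real.sqrt_nonneg _)
      (Finset.mem_univ a.1))

theorem dupMat_mul_apply (W : Matrix (Fin d) (Fin p) ℝ) (a : Dup 𝒢) (j : Fin p) :
    (dupMat 𝒢 * W) a j = W a.2 j := by
  simp [dupMat, Matrix.mul_apply]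

theorem groupLasso_eq (W : Matrix (Fin d) (Fin p) ℝ) :
    groupLasso 𝒢 W = groupLasso' (dupMat 𝒢 * W) := by
  unfold groupLasso groupLasso'
  rw [← Finset.sum_coe_sort 𝒢]
  refine Finset.sum_congr rfl fun g _ => ?_
  congr 1
  ext i j
  simp [block, dupMat_mul_apply]

end Penalties

/-! ### Pairs of matrices as one Euclidean vector -/

section Stack

variable {m m' q : Type*}

/-- Two matrices with the same column index set as one Euclidean vector. -/
def stack : (Matrix m q ℝ × Matrix m' q ℝ) ≃ₗ[ℝ] EuclideanSpace ℝ ((m × q) ⊕ (m' × q)) where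
  toFun A := WithLp.toLp 2 (Sum.elim (fun i => A.1 i.1 i.2) (fun i => A.2 i.1 i.2))
  invFun u := (Matrix.of fun i j => u (Sum.inl (i, j)), Matrix.of fun i j => u (Sum.inr (i, j)))
  left_inv _ := rfl
  right_inv u := by ext (i | i) <;> rfl
  map_add' A B := by ext (i | i) <;> rfl
  map_smul' t A := by ext (i | i) <;> rfl

@[simp]
theorem stack_inl (A : Matrix m q ℝ × Matrix m' q ℝ) (i : m × q) :
    stack A (Sum.inl i) = A.1 i.1 i.2 := rfl

@[simp]
theorem stack_inr (A : Matrix m q ℝ × Matrix m' q ℝ) (i : m' × q) :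
    stack A (Sum.inr i) = A.2 i.1 i.2 := rfl

variable [Fintype m] [Fintype m'] [Fintype q]

theorem inner_stack (A B : Matrix m q ℝ × Matrix m' q ℝ) :
    inner ℝ (stack A) (stack B) = inn A.1 B.1 + inn A.2 B.2 := by
  simp [PiLp.inner_apply, Fintype.sum_prod_type, inn, mul_comm]

theorem continuous_stack_symm :
    Continuous (stack (m := m) (m' := m') (q := q)).symm :=
  LinearMap.continuous_of_finiteDimensional (stack (m := m) (m' := m') (q := q)).symm.toLinearMap

theorem norm_stack_le {A : Matrix m q ℝ × Matrix m' q ℝ} {R : ℝ}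
    (h₁ : ∀ i j, |A.1 i j| ≤ R) (h₂ : ∀ i j, |A.2 i j| ≤ R) :
    ‖stack A‖ ≤ Real.sqrt (∑ _i : (m × q) ⊕ (m' × q), R ^ 2) := by
  rw [EuclideanSpace.norm_eq]
  refine Real.sqrt_le_sqrt (Finset.sum_le_sum fun i _ => ?_)
  rw [Real.norm_eq_abs]
  refine pow_le_pow_left₀ (abs_nonneg _) ?_ 2
  rcases i with i | i
  · exact h₁ i.1 i.2
  · exact h₂ i.1 i.2

end Stack

/-! ### The algorithm as a semi-proximal ADMM -/

namespace Problem

variable {n d p : ℕ} (P : Problem n d p)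

theorem C_mulVec_injective (hcover : ∀ i : Fin d, ∃ g ∈ P.𝒢, i ∈ g) :
    Function.Injective P.C.mulVec := by
  intro x y h
  ext i
  obtain ⟨g, hg, hi⟩ := hcover i
  simpa [dupMat, Matrix.mulVec, dotProduct] using congrFun h (⟨⟨g, hg⟩, ⟨i, hi⟩⟩ : Dup P.𝒢)

theorem isUnit_det_A (hcover : ∀ i : Fin d, ∃ g ∈ P.𝒢, i ∈ g) : IsUnit P.A.det := by
  have h₁ : (P.Cᵀ * P.C).PosDef := by
    simpa using Matrix.PosDef.conjTranspose_mul_self P.C (P.C_mulVec_injective hcover)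
  have h₂ : (P.Xᵀ * P.X).PosSemidef := by
    simpa using Matrix.posSemidef_conjTranspose_mul_self P.X
  exact (Matrix.isUnit_iff_isUnit_det _).1 (Matrix.PosDef.posSemidef_add h₂ h₁).isUnit

theorem A_mul_updW (hA : IsUnit P.A.det) (Z : Matrix (Fin n) (Fin p) ℝ)
    (Υ : Matrix (Dup P.𝒢) (Fin p) ℝ) (G : Matrix (Fin n) (Fin p) ℝ) :
    P.A * P.updW Z Υ G = P.Xᵀ * (P.Y - Z - G) + P.Cᵀ * Υ :=
  Matrix.mul_nonsing_inv_cancel_left _ _ hA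

/-- The part of the split objective that depends on the first block `(Z, Υ)`. -/
def fstObj (u : EuclideanSpace ℝ ((Fin n × Fin p) ⊕ (Dup P.𝒢 × Fin p))) : ℝ :=
  l21 (stack.symm u).1 + P.lam * groupLasso' (stack.symm u).2

/-- The part of the split objective that depends on the second block `(G, W)`. -/
def sndObj (v : Matrix (Fin n) (Fin p) ℝ × Matrix (Fin d) (Fin p) ℝ) : ℝ :=
  P.ρ * l1 v.1

/-- The constraint map of the second block, `(G, W) ↦ (G + X W, -C W)`. -/
def sndMap : (Matrix (Fin n) (Fin p) ℝ × Matrix (Fin d) (Fin p) ℝ) →ₗ[ℝ]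
    EuclideanSpace ℝ ((Fin n × Fin p) ⊕ (Dup P.𝒢 × Fin p)) where
  toFun v := stack (v.1 + P.X * v.2, -(P.C * v.2))
  map_add' v w := by
    rw [← map_add]
    congr 1
    ext1
    · simp only [Prod.fst_add, Prod.snd_add, Matrix.mul_add]; abel
    · simp only [Prod.snd_add, Matrix.mul_add]; abel
  map_smul' t v := by
    rw [← map_smul]
    congr 1
    ext1 <;> simp

/-- The map whose squared norm is the symmetric Gauss-Seidel proximal term in `(G, W)`. -/
def proxMap : (Matrix (Fin n) (Fin p) ℝ × Matrix (Fin d) (Fin p) ℝ) →ₗ[ℝ]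
    EuclideanSpace ℝ ((Fin n × Fin p) ⊕ (Dup P.𝒢 × Fin p)) where
  toFun v := stack (P.X * (P.A⁻¹ * (P.Xᵀ * v.1)), P.C * (P.A⁻¹ * (P.Xᵀ * v.1)))
  map_add' v w := by
    rw [← map_add]
    congr 1
    ext1 <;> simp [Matrix.mul_add]
  map_smul' t v := by
    rw [← map_smul]
    congr 1
    ext1 <;> simp

theorem continuous_fstObj : Continuous P.fstObj := by
  unfold fstObj
  exact (continuous_l21.comp (continuous_fst.comp continuous_stack_symm)).add
    ((continuous_groupLasso'.comp (continuous_snd.comp continuous_stack_symm)).const_mul _)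

theorem continuous_sndObj : Continuous P.sndObj :=
  (continuous_l1.comp continuous_fst).const_mul _

theorem convexOn_fstObj (hlam : 0 < P.lam) : ConvexOn ℝ Set.univ P.fstObj :=
  (convexOn_l21.comp_linearMap (LinearMap.fst ℝ _ _ ∘ₗ stack.symm.toLinearMap)).add
    ((convexOn_groupLasso'.comp_linearMap
      (LinearMap.snd ℝ _ _ ∘ₗ stack.symm.toLinearMap)).smul hlam.le)

theorem convexOn_sndObj (hρ : 0 < P.ρ) : ConvexOn ℝ Set.univ P.sndObj :=
  (convexOn_l1.comp_linearMap (LinearMap.fst ℝ _ _)).smul hρ.le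

theorem sndObj_nonneg (hρ : 0 < P.ρ) (v) : 0 ≤ P.sndObj v :=
  mul_nonneg hρ.le (l1_nonneg _)

theorem isBounded_fstObj_le (hlam : 0 < P.lam) (M : ℝ) :
    Bornology.IsBounded {u | P.fstObj u ≤ M} := by
  refine isBounded_iff_forall_norm_le.2 ⟨Real.sqrt
    (∑ _i : (Fin n × Fin p) ⊕ (Dup P.𝒢 × Fin p), max M (M / P.lam) ^ 2), fun u hu => ?_⟩
  obtain ⟨A, rfl⟩ := stack.surjective u
  simp only [fstObj, LinearEquiv.symm_apply_apply, Set.mem_ofPred_eq] at hu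
  have h₁ := mul_nonneg hlam.le (groupLasso'_nonneg A.2)
  refine norm_stack_le (fun i j => ?_) fun a j => ?_
  · exact (abs_le_l21 A.1 i j).trans ((by linarith : l21 A.1 ≤ M).trans (le_max_left _ _))
  · refine (abs_le_groupLasso' A.2 a j).trans (le_trans ?_ (le_max_right _ _))
    rw [le_div_iff₀ hlam]
    linarith [l21_nonneg A.1]

theorem sndMap_injective (hcover : ∀ i : Fin d, ∃ g ∈ P.𝒢, i ∈ g) :
    Function.Injective P.sndMap := by
  rw [← LinearMap.ker_eq_bot, LinearMap.ker_eq_bot']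
  rintro ⟨G, W⟩ h
  have h' : (G + P.X * W, -(P.C * W)) = 0 := stack.injective (by rw [map_zero]; exact h)
  obtain ⟨h₁, h₂⟩ := Prod.mk_eq_zero.1 h'
  have hW : W = 0 := by
    ext i j
    obtain ⟨g, hg, hi⟩ := hcover i
    have := congrFun (congrFun (neg_eq_zero.1 h₂) (⟨⟨g, hg⟩, ⟨i, hi⟩⟩ : Dup P.𝒢)) j
    rwa [dupMat_mul_apply] at this
  subst hW
  simpa using h₁

theorem updZ_mem_subdiff {σ : ℝ} (hσ : 0 < σ) (G : Matrix (Fin n) (Fin p) ℝ)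
    (W : Matrix (Fin d) (Fin p) ℝ) (Λ₁ : Matrix (Fin n) (Fin p) ℝ) :
    Λ₁ - σ • (P.updZ σ G W Λ₁ + (G + P.X * W) - P.Y) ∈ subdiff l21 (P.updZ σ G W Λ₁) := by
  intro B
  set Δ := P.Y - P.X * W - G + σ⁻¹ • Λ₁ with hΔ
  set Z := P.updZ σ G W Λ₁ with hZ
  have e : Λ₁ - σ • (Z + (G + P.X * W) - P.Y) = σ • (Δ - Z) := by
    conv_lhs => rw [← smul_inv_smul₀ hσ.ne' Λ₁]
    rw [hΔ]
    module
  have hcol : ∀ j, colVec j Z = max (1 - 1 / (σ * ‖colVec j Δ‖)) 0 • colVec j Δ := fun j => by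
    rw [← colNorm_eq_norm]; rfl
  rw [e, inn_eq_sum_inner_colVec, l21_eq, l21_eq, ← Finset.sum_add_distrib]
  refine Finset.sum_le_sum fun j _ => ?_
  simpa using shrink_subgradient zero_le_one hσ (hcol j) (colVec j B)

theorem updΥ_subgradient (hlam : 0 < P.lam) {σ : ℝ} (hσ : 0 < σ)
    (W : Matrix (Fin d) (Fin p) ℝ) (Λ₂ B : Matrix (Dup P.𝒢) (Fin p) ℝ) :
    P.lam * groupLasso' (P.updΥ σ W Λ₂)
      + inn (Λ₂ - σ • (P.updΥ σ W Λ₂ - P.C * W)) (B - P.updΥ σ W Λ₂)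
      ≤ P.lam * groupLasso' B := by
  set Δ := P.C * W + σ⁻¹ • Λ₂ with hΔ
  set Υ := P.updΥ σ W Λ₂ with hΥ
  have e : Λ₂ - σ • (Υ - P.C * W) = σ • (Δ - Υ) := by
    conv_lhs => rw [← smul_inv_smul₀ hσ.ne' Λ₂]
    rw [hΔ]
    module
  have hblock : ∀ g, blockVec g Υ
      = max (1 - P.lam / (σ * ‖blockVec g Δ‖)) 0 • blockVec g Δ := fun g => by
    change _ = max (1 - P.lam / (σ * ‖flat (block Δ g)‖)) 0 • _
    rw [← frob_eq_norm]; rfl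
  rw [e, inn_eq_sum_inner_blockVec, groupLasso'_eq, groupLasso'_eq, Finset.mul_sum,
    Finset.mul_sum, ← Finset.sum_add_distrib]
  refine Finset.sum_le_sum fun g _ => ?_
  simpa only [map_smul, map_sub] using shrink_subgradient hlam.le hσ (hblock g) (blockVec g B)

theorem updG_subgradient (hρ : 0 < P.ρ) {σ : ℝ} (hσ : 0 < σ) (Z : Matrix (Fin n) (Fin p) ℝ)
    (W : Matrix (Fin d) (Fin p) ℝ) (Λ₁ B : Matrix (Fin n) (Fin p) ℝ) :
    P.ρ * l1 (P.updG σ Z W Λ₁)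
      + inn (Λ₁ - σ • (Z + P.X * W + P.updG σ Z W Λ₁ - P.Y)) (B - P.updG σ Z W Λ₁)
      ≤ P.ρ * l1 B := by
  set Δ := P.Y - P.X * W - Z + σ⁻¹ • Λ₁ with hΔ
  set G := P.updG σ Z W Λ₁ with hG
  have e : Λ₁ - σ • (Z + P.X * W + G - P.Y) = σ • (Δ - G) := by
    conv_lhs => rw [← smul_inv_smul₀ hσ.ne' Λ₁]
    rw [hΔ]
    module
  rw [e]
  simp only [l1, inn, Finset.mul_sum, ← Finset.sum_add_distrib]
  refine Finset.sum_le_sum fun i _ => Finset.sum_le_sum fun j _ => ?_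
  have := shrink_subgradient hρ.le hσ (x := Δ i j) (s := G i j)
    (soft_threshold_eq hσ (Δ i j)) (B i j)
  simpa [mul_comm] using this

/-- Exact minimization over `W` makes the residual orthogonal to the range of `W ↦ (X W, -C W)`.
Multiplier updates along such residuals therefore preserve `Xᵀ Λ₁ = Cᵀ Λ₂`. -/
theorem normal_equation (hA : IsUnit P.A.det) (Z : Matrix (Fin n) (Fin p) ℝ)
    (Υ : Matrix (Dup P.𝒢) (Fin p) ℝ) (G : Matrix (Fin n) (Fin p) ℝ) :
    P.Xᵀ * (Z + P.X * P.updW Z Υ G + G - P.Y) - P.Cᵀ * (Υ - P.C * P.updW Z Υ G) = 0 := by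
  have h := P.A_mul_updW hA Z Υ G
  rw [A, Matrix.add_mul, Matrix.mul_assoc, Matrix.mul_assoc, ← sub_eq_zero] at h
  rw [← h]
  simp only [Matrix.mul_add, Matrix.mul_sub]
  abel

theorem stationary_sub_smul {Λ₁ r₁ : Matrix (Fin n) (Fin p) ℝ}
    {Λ₂ r₂ : Matrix (Dup P.𝒢) (Fin p) ℝ} (hΛ : P.Xᵀ * Λ₁ - P.Cᵀ * Λ₂ = 0)
    (hr : P.Xᵀ * r₁ - P.Cᵀ * r₂ = 0) (t : ℝ) :
    P.Xᵀ * (Λ₁ - t • r₁) - P.Cᵀ * (Λ₂ - t • r₂) = 0 := by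
  have : P.Xᵀ * (Λ₁ - t • r₁) - P.Cᵀ * (Λ₂ - t • r₂)
      = (P.Xᵀ * Λ₁ - P.Cᵀ * Λ₂) - t • (P.Xᵀ * r₁ - P.Cᵀ * r₂) := by
    simp only [Matrix.mul_sub, Matrix.mul_smul]
    module
  rw [this, hΛ, hr, smul_zero, sub_zero]

theorem iter_succ (σ τ : ℝ) (s₀ : State n d p P.𝒢) (k : ℕ) :
    P.iter σ τ s₀ (k + 1) = P.step σ τ (P.iter σ τ s₀ k) :=
  Function.iterate_succ_apply' _ _ _

theorem iter_stationary (hA : IsUnit P.A.det) (σ τ : ℝ) {s₀ : State n d p P.𝒢}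
    (hs : P.Xᵀ * s₀.Λ₁ - P.Cᵀ * s₀.Λ₂ = 0) (k : ℕ) :
    P.Xᵀ * (P.iter σ τ s₀ k).Λ₁ - P.Cᵀ * (P.iter σ τ s₀ k).Λ₂ = 0 := by
  induction k with
  | zero => exact hs
  | succ k ih =>
    rw [iter_succ]
    exact P.stationary_sub_smul ih (P.normal_equation hA _ _ _) (τ * σ)

theorem stack_add_sndMap_sub (Z : Matrix (Fin n) (Fin p) ℝ) (Υ : Matrix (Dup P.𝒢) (Fin p) ℝ)
    (G : Matrix (Fin n) (Fin p) ℝ) (W : Matrix (Fin d) (Fin p) ℝ) :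
    stack (Z, Υ) + P.sndMap (G, W) - stack (P.Y, 0)
      = stack (Z + (G + P.X * W) - P.Y, Υ - P.C * W) := by
  change stack (Z, Υ) + stack (G + P.X * W, -(P.C * W)) - stack (P.Y, 0) = _
  rw [← map_add, ← map_sub]
  congr 1
  ext1
  · rfl
  · simp [sub_eq_add_neg]

theorem stack_sub_smul (A B : Matrix (Fin n) (Fin p) ℝ × Matrix (Dup P.𝒢) (Fin p) ℝ) (t : ℝ) :
    stack A - t • stack B = stack (A.1 - t • B.1, A.2 - t • B.2) := by
  rw [← map_smul, ← map_sub]; rfl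

theorem inner_stack_sndMap (Λ₁ : Matrix (Fin n) (Fin p) ℝ) (Λ₂ : Matrix (Dup P.𝒢) (Fin p) ℝ)
    (v : Matrix (Fin n) (Fin p) ℝ × Matrix (Fin d) (Fin p) ℝ) :
    inner ℝ (stack (Λ₁, Λ₂)) (P.sndMap v)
      = inn Λ₁ v.1 + inn (P.Xᵀ * Λ₁ - P.Cᵀ * Λ₂) v.2 := by
  change inner ℝ (stack (Λ₁, Λ₂)) (stack (v.1 + P.X * v.2, -(P.C * v.2))) = _
  rw [inner_stack, inn_add_right, inn_neg_right, inn_mul_right, inn_mul_right, inn_sub_left]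
  ring

/-- With `E = A⁻¹ Xᵀ G`, the identity `XᵀX + CᵀC = A` collapses the two components into a pairing
with `A E = Xᵀ G`. This exhibits `X A⁻¹ Xᵀ` as a Gram operator without taking a square root. -/
theorem inner_proxMap (hA : IsUnit P.A.det)
    (v w : Matrix (Fin n) (Fin p) ℝ × Matrix (Fin d) (Fin p) ℝ) :
    inner ℝ (P.proxMap v) (P.proxMap w) = inn (P.X * (P.A⁻¹ * (P.Xᵀ * v.1))) w.1 := by
  have h : P.A * (P.A⁻¹ * (P.Xᵀ * w.1)) = P.Xᵀ * w.1 :=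
    Matrix.mul_nonsing_inv_cancel_left _ _ hA
  rw [A, Matrix.add_mul, Matrix.mul_assoc, Matrix.mul_assoc, ← A] at h
  change inner ℝ (stack (P.X * (P.A⁻¹ * (P.Xᵀ * v.1)), P.C * (P.A⁻¹ * (P.Xᵀ * v.1))))
    (stack (P.X * (P.A⁻¹ * (P.Xᵀ * w.1)), P.C * (P.A⁻¹ * (P.Xᵀ * w.1)))) = _
  generalize P.A⁻¹ * (P.Xᵀ * v.1) = E at *
  rw [inner_stack, inn_comm (P.X * E), inn_comm (P.C * E), inn_mul_right, inn_mul_right,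
    ← inn_add_left, h, ← inn_mul_right, inn_comm]

theorem updW_sub_updW (Z : Matrix (Fin n) (Fin p) ℝ) (Υ : Matrix (Dup P.𝒢) (Fin p) ℝ)
    (G G' : Matrix (Fin n) (Fin p) ℝ) :
    P.A⁻¹ * (P.Xᵀ * (G' - G)) = P.updW Z Υ G - P.updW Z Υ G' := by
  unfold updW
  rw [← Matrix.mul_sub]
  congr 1
  simp only [Matrix.mul_sub]
  abel

/-- The algorithm is a semi-proximal ADMM: the symmetric Gauss-Seidel sweep over `(W, G)` is a
proximal step in `(G, W)` jointly. -/
theorem isProxADMM_iter (hA : IsUnit P.A.det) (hlam : 0 < P.lam) (hρ : 0 < P.ρ) {σ : ℝ}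
    (hσ : 0 < σ) (τ : ℝ) {s₀ : State n d p P.𝒢} (hs : P.Xᵀ * s₀.Λ₁ - P.Cᵀ * s₀.Λ₂ = 0) :
    IsProxADMM P.fstObj P.sndObj P.sndMap P.proxMap (stack (P.Y, 0)) σ τ
      (fun k => stack ((P.iter σ τ s₀ k).Z, (P.iter σ τ s₀ k).Υ))
      (fun k => ((P.iter σ τ s₀ k).G, (P.iter σ τ s₀ k).W))
      (fun k => stack ((P.iter σ τ s₀ k).Λ₁, (P.iter σ τ s₀ k).Λ₂)) where
  left k u' := by
    obtain ⟨⟨Z', Υ'⟩, rfl⟩ := stack.surjective u'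
    rw [iter_succ]
    set s := P.iter σ τ s₀ k
    rw [stack_add_sndMap_sub, stack_sub_smul, ← map_sub, inner_stack]
    have h₁ := P.updZ_mem_subdiff hσ s.G s.W s.Λ₁ Z'
    have h₂ := P.updΥ_subgradient hlam hσ s.W s.Λ₂ Υ'
    simp only [fstObj, LinearEquiv.symm_apply_apply]
    change l21 (P.updZ σ s.G s.W s.Λ₁) + P.lam * groupLasso' (P.updΥ σ s.W s.Λ₂)
      + (inn (s.Λ₁ - σ • (P.updZ σ s.G s.W s.Λ₁ + (s.G + P.X * s.W) - P.Y))
          (Z' - P.updZ σ s.G s.W s.Λ₁)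
        + inn (s.Λ₂ - σ • (P.updΥ σ s.W s.Λ₂ - P.C * s.W)) (Υ' - P.updΥ σ s.W s.Λ₂)) ≤ _
    exact le_of_eq_of_le (by ring) (add_le_add h₁ h₂)
  right k v' := by
    obtain ⟨G', W'⟩ := v'
    have hst := P.iter_stationary hA σ τ hs k
    rw [iter_succ]
    set s := P.iter σ τ s₀ k
    set Z := P.updZ σ s.G s.W s.Λ₁ with hZ
    set Υ := P.updΥ σ s.W s.Λ₂ with hΥ
    set G := P.updG σ Z (P.updW Z Υ s.G) s.Λ₁ with hG
    rw [stack_add_sndMap_sub, stack_sub_smul, inner_stack_sndMap, inner_proxMap P hA]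
    change P.ρ * l1 G + (inn (s.Λ₁ - σ • (Z + (G + P.X * P.updW Z Υ G) - P.Y)) (G' - G)
      + inn (P.Xᵀ * (s.Λ₁ - σ • (Z + (G + P.X * P.updW Z Υ G) - P.Y))
        - P.Cᵀ * (s.Λ₂ - σ • (Υ - P.C * P.updW Z Υ G))) (W' - P.updW Z Υ G))
      - σ * inn (P.X * (P.A⁻¹ * (P.Xᵀ * (G - s.G)))) (G' - G) ≤ P.ρ * l1 G'
    have e : Z + (G + P.X * P.updW Z Υ G) - P.Y = Z + P.X * P.updW Z Υ G + G - P.Y := by abel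
    -- The `W` component drops out by stationarity, and `A⁻¹ Xᵀ (G - s.G)` is the half step minus
    -- the final `W`; the proximal term thus replaces the final `W` by the half step in the
    -- residual.
    rw [e, P.stationary_sub_smul hst (P.normal_equation hA Z Υ G) σ, inn_zero_left, add_zero,
      P.updW_sub_updW Z Υ, ← inn_smul_left, add_sub_assoc, ← inn_sub_left]
    have h := P.updG_subgradient hρ hσ Z (P.updW Z Υ s.G) s.Λ₁ G'
    convert h using 3
    rw [Matrix.mul_sub]
    module
  dual k := by
    rw [iter_succ, stack_add_sndMap_sub, stack_sub_smul, ← add_assoc, add_right_comm]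
    rfl

/-! ### KKT conditions, optimality and duality -/

theorem kkt_of_splitKKT (hlam : 0 < P.lam) (hρ : 0 < P.ρ) {Z : Matrix (Fin n) (Fin p) ℝ}
    {Υ : Matrix (Dup P.𝒢) (Fin p) ℝ} {G : Matrix (Fin n) (Fin p) ℝ}
    {W : Matrix (Fin d) (Fin p) ℝ} {Λ₁ : Matrix (Fin n) (Fin p) ℝ}
    {Λ₂ : Matrix (Dup P.𝒢) (Fin p) ℝ}
    (h : SplitKKT P.fstObj P.sndObj P.sndMap (stack (P.Y, 0)) (stack (Z, Υ)) (G, W)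
      (stack (Λ₁, Λ₂))) : P.KKT ⟨Z, Υ, G, W, Λ₁, Λ₂⟩ := by
  have hfeas := sub_eq_zero.2 h.feasible
  rw [stack_add_sndMap_sub, LinearEquiv.map_eq_zero_iff, Prod.mk_eq_zero] at hfeas
  have hl : ∀ Z' Υ', l21 Z + P.lam * groupLasso' Υ + (inn Λ₁ (Z' - Z) + inn Λ₂ (Υ' - Υ))
      ≤ l21 Z' + P.lam * groupLasso' Υ' := fun Z' Υ' => by
    have := h.left (stack (Z', Υ'))
    rw [← map_sub, inner_stack] at this
    simp only [fstObj, LinearEquiv.symm_apply_apply] at this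
    exact this
  have hr : ∀ G' W', P.ρ * l1 G + (inn Λ₁ (G' - G) + inn (P.Xᵀ * Λ₁ - P.Cᵀ * Λ₂) (W' - W))
      ≤ P.ρ * l1 G' := fun G' W' => by
    have := h.right (G', W')
    rwa [inner_stack_sndMap] at this
  refine ⟨?_, sub_eq_zero.1 hfeas.2, fun B => ?_, ?_, ?_, ?_⟩
  · rw [← sub_eq_zero, ← hfeas.1]; abel
  · have := hl B Υ
    rw [sub_self, inn_zero_right] at this
    linarith
  · refine (Set.mem_smul_set_iff_inv_smul_mem₀ hρ.ne' _ _).2 fun B => ?_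
    have := hr B W
    rw [sub_self, inn_zero_right] at this
    rw [inn_smul_left]
    refine le_of_mul_le_mul_left ?_ hρ
    rw [mul_add, mul_inv_cancel_left₀ hρ.ne']
    linarith
  · refine (Set.mem_smul_set_iff_inv_smul_mem₀ hlam.ne' _ _).2 fun B => ?_
    have := hl Z B
    rw [sub_self, inn_zero_right] at this
    rw [inn_smul_left]
    refine le_of_mul_le_mul_left ?_ hlam
    rw [mul_add, mul_inv_cancel_left₀ hlam.ne']
    linarith
  · refine eq_zero_of_inn_self_nonpos ?_
    -- The objective does not depend on `W`; moving along the gradient itself bounds its squared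
    -- norm by zero.
    have := hr G (W + (P.Xᵀ * Λ₁ - P.Cᵀ * Λ₂))
    rw [sub_self, inn_zero_right, add_sub_cancel_left] at this
    linarith

/-- The three subgradient inequalities add up, and stationarity cancels the terms in `W`. On
feasible points this is primal optimality; as a lower bound for the dual function it is strong
duality. -/
theorem KKT.obj_le_lagrangian {P : Problem n d p} {s : State n d p P.𝒢} (h : P.KKT s)
    (hlam : 0 < P.lam) (hρ : 0 < P.ρ) (Z : Matrix (Fin n) (Fin p) ℝ)
    (Υ : Matrix (Dup P.𝒢) (Fin p) ℝ) (G : Matrix (Fin n) (Fin p) ℝ)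
    (W : Matrix (Fin d) (Fin p) ℝ) :
    P.obj s.Z s.Υ s.G ≤ P.lagrangian Z Υ G W s.Λ₁ s.Λ₂ := by
  obtain ⟨h₁, h₂, h₃, h₄, h₅, h₆⟩ := h
  have hZ := h₃ Z
  have hG := mul_le_mul_of_nonneg_left
    ((Set.mem_smul_set_iff_inv_smul_mem₀ hρ.ne' _ _).1 h₄ G) hρ.le
  have hΥ := mul_le_mul_of_nonneg_left
    ((Set.mem_smul_set_iff_inv_smul_mem₀ hlam.ne' _ _).1 h₅ Υ) hlam.le
  rw [inn_smul_left, mul_add, mul_inv_cancel_left₀ hρ.ne'] at hG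
  rw [inn_smul_left, mul_add, mul_inv_cancel_left₀ hlam.ne'] at hΥ
  have hW : inn s.Λ₁ (P.X * (W - s.W)) - inn s.Λ₂ (P.C * (W - s.W)) = 0 := by
    rw [inn_mul_right, inn_mul_right, ← inn_sub_left, h₆, inn_zero_left]
  have e₁ : Z + G + P.X * W - P.Y = (Z - s.Z) + (G - s.G) + P.X * (W - s.W) := by
    rw [← h₁, Matrix.mul_sub]; abel
  have e₂ : Υ - P.C * W = (Υ - s.Υ) - P.C * (W - s.W) := by
    rw [h₂, Matrix.mul_sub]; abel
  unfold lagrangian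
  rw [e₁, e₂, inn_add_right, inn_add_right, inn_sub_right s.Λ₂ (Υ - s.Υ)]
  unfold obj
  linarith

theorem lagrangian_eq_obj {P : Problem n d p} {Z : Matrix (Fin n) (Fin p) ℝ}
    {Υ : Matrix (Dup P.𝒢) (Fin p) ℝ} {G : Matrix (Fin n) (Fin p) ℝ}
    {W : Matrix (Fin d) (Fin p) ℝ} (h : P.Feasible Z Υ G W)
    (Λ₁ : Matrix (Fin n) (Fin p) ℝ) (Λ₂ : Matrix (Dup P.𝒢) (Fin p) ℝ) :
    P.lagrangian Z Υ G W Λ₁ Λ₂ = P.obj Z Υ G := by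
  unfold lagrangian
  rw [h.1, h.2, sub_self, inn_zero_right, inn_zero_right, sub_zero, sub_zero]

theorem KKT.feasible {P : Problem n d p} {s : State n d p P.𝒢} (h : P.KKT s) :
    P.Feasible s.Z s.Υ s.G s.W :=
  ⟨h.1, sub_eq_zero.2 h.2.1⟩

theorem KKT.isOptimal {P : Problem n d p} {s : State n d p P.𝒢} (h : P.KKT s)
    (hlam : 0 < P.lam) (hρ : 0 < P.ρ) : P.IsOptimal s.Z s.Υ s.G s.W :=
  ⟨h.feasible, fun Z Υ G W hf =>
    (h.obj_le_lagrangian hlam hρ Z Υ G W).trans_eq (lagrangian_eq_obj hf _ _)⟩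

theorem objOrig_eq_obj (W : Matrix (Fin d) (Fin p) ℝ) (G : Matrix (Fin n) (Fin p) ℝ) :
    P.objOrig W G = P.obj (P.Y - P.X * W - G) (P.C * W) G := by
  rw [objOrig, obj, groupLasso_eq]

theorem IsOptimal.isOptimalOrig {P : Problem n d p} {Z : Matrix (Fin n) (Fin p) ℝ}
    {Υ : Matrix (Dup P.𝒢) (Fin p) ℝ} {G : Matrix (Fin n) (Fin p) ℝ}
    {W : Matrix (Fin d) (Fin p) ℝ} (h : P.IsOptimal Z Υ G W) : P.IsOptimalOrig W G := by
  intro W' G'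
  have hZ : P.Y - P.X * W - G = Z := by rw [← h.1.1]; abel
  rw [objOrig_eq_obj, objOrig_eq_obj, hZ, ← sub_eq_zero.1 h.1.2]
  exact h.2 _ _ _ W' ⟨by abel, sub_self _⟩

theorem KKT.isDualOptimal {P : Problem n d p} {s : State n d p P.𝒢} (h : P.KKT s)
    (hlam : 0 < P.lam) (hρ : 0 < P.ρ) : P.IsDualOptimal s.Λ₁ s.Λ₂ := by
  have hle : ((P.obj s.Z s.Υ s.G : ℝ) : EReal) ≤ P.dualFun s.Λ₁ s.Λ₂ :=
    le_iInf fun Z => le_iInf fun Υ => le_iInf fun G => le_iInf fun W =>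
      EReal.coe_le_coe_iff.2 (h.obj_le_lagrangian hlam hρ Z Υ G W)
  refine ⟨fun hbot => ?_, fun Λ₁ Λ₂ => le_trans ?_ hle⟩
  · rw [hbot] at hle
    exact EReal.coe_ne_bot _ (le_bot_iff.1 hle)
  · rw [← lagrangian_eq_obj h.feasible Λ₁ Λ₂]
    exact iInf_le_of_le s.Z (iInf_le_of_le s.Υ (iInf_le_of_le s.G (iInf_le _ s.W)))

end Problem

/-! ### Limits of tuples and the main theorem -/

theorem ConvergesTo.unique {n d p : ℕ} {𝒢 : Finset (Finset (Fin d))} {s : ℕ → State n d p 𝒢}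
    {l l' : State n d p 𝒢} (h : ConvergesTo s l) (h' : ConvergesTo s l') : l = l' := by
  obtain ⟨h₁, h₂, h₃, h₄, h₅, h₆⟩ := h
  obtain ⟨h₁', h₂', h₃', h₄', h₅', h₆'⟩ := h'
  exact State.ext (tendsto_nhds_unique h₁ h₁') (tendsto_nhds_unique h₂ h₂')
    (tendsto_nhds_unique h₃ h₃') (tendsto_nhds_unique h₄ h₄') (tendsto_nhds_unique h₅ h₅')
    (tendsto_nhds_unique h₆ h₆')

theorem tendsto_of_tendsto_stack {m m' q : Type*} [Fintype m] [Fintype m'] [Fintype q]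
    {A : ℕ → Matrix m q ℝ} {A' : ℕ → Matrix m' q ℝ} {B : Matrix m q ℝ} {B' : Matrix m' q ℝ}
    (h : Tendsto (fun k => stack (A k, A' k)) atTop (𝓝 (stack (B, B')))) :
    Tendsto A atTop (𝓝 B) ∧ Tendsto A' atTop (𝓝 B') := by
  have h' := (continuous_stack_symm.tendsto _).comp h
  simp only [Function.comp_def, LinearEquiv.symm_apply_apply] at h'
  exact ⟨(continuous_fst.tendsto _).comp h', (continuous_snd.tendsto _).comp h'⟩

end CMRG

end

theorem theorem1 {n d p : ℕ} (P : CMRG.Problem n d p)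
    (hcover : ∀ i : Fin d, ∃ g ∈ P.𝒢, i ∈ g)
    (hlam : 0 < P.lam) (hρ : 0 < P.ρ)
    (σ τ : ℝ) (hσ : 0 < σ) (hτ₀ : 0 < τ) (hτ₁ : τ < (1 + Real.sqrt 5) / 2)
    (s₀ : CMRG.State n d p P.𝒢) (hinit : P.IsInit s₀) :
    ∃! l : CMRG.State n d p P.𝒢,
      CMRG.ConvergesTo (P.iter σ τ s₀) l ∧
      P.KKT l ∧
      P.IsOptimal l.Z l.Υ l.G l.W ∧
      P.IsOptimalOrig l.W l.G ∧
      P.IsDualOptimal l.Λ₁ l.Λ₂ := by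
  have hA := P.isUnit_det_A hcover
  have hB := P.sndMap_injective hcover
  obtain ⟨a, ⟨G, W⟩, M, hs, hu, hv, hΛ⟩ :=
    (P.isProxADMM_iter hA hlam hρ hσ τ hinit.2).exists_tendsto P.continuous_fstObj
      P.continuous_sndObj hB hσ hτ₀ hτ₁
      (CMRG.exists_splitKKT P.continuous_fstObj P.continuous_sndObj (P.convexOn_fstObj hlam)
        (P.convexOn_sndObj hρ) (P.isBounded_fstObj_le hlam) (P.sndObj_nonneg hρ) hB _)
  obtain ⟨⟨Z, Υ⟩, rfl⟩ := CMRG.stack.surjective a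
  obtain ⟨⟨Λ₁, Λ₂⟩, rfl⟩ := CMRG.stack.surjective M
  have hkkt := P.kkt_of_splitKKT hlam hρ hs
  have hopt := hkkt.isOptimal hlam hρ
  have hconv : CMRG.ConvergesTo (P.iter σ τ s₀) ⟨Z, Υ, G, W, Λ₁, Λ₂⟩ :=
    ⟨(CMRG.tendsto_of_tendsto_stack hu).1, (CMRG.tendsto_of_tendsto_stack hu).2,
      (continuous_fst.tendsto _).comp hv, (continuous_snd.tendsto _).comp hv,
      (CMRG.tendsto_of_tendsto_stack hΛ).1, (CMRG.tendsto_of_tendsto_stack hΛ).2⟩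
  exact ⟨_, ⟨hconv, hkkt, hopt, hopt.isOptimalOrig, hkkt.isDualOptimal hlam hρ⟩,
    fun l hl => hl.1.unique hconv⟩
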